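/- **Model.** A typical receiver sits at a fixed point $y_0\in\mathbb R^2$; its transmitter $x_0$ is at distance $r_0>0$ from $y_0$ in a uniformly random direction. The remaining transmitters $\Phi_T\setminus\{x_0\}$ and the remaining receivers $\Phi_R\setminus\{y_0\}$ form homogeneous Poisson point processes (PPPs) on $\mathbb R^2$ of intensity $\lambda>0$, and the eavesdroppers form a homogeneous PPP $\Phi_E$ of intensity $\lambda_E>0$; these three processes and the direction of $x_0$ are independent. A link of length $r$ has status $k\in\{L,N\}$ (line of sight or not) with probability $p_L(r)=e^{-\beta r}$, $p_N(r)=1-e^{-\beta r}$, where $\beta>0$; its path loss is $r^{\alpha_k}$, where $0<\alpha_L<\alpha_N$, and given its status its channel gain $h$ is gamma distributed with shape $N_k$ and rate $N_k$, where $N_L>N_N\ge 1$ are integers. A sending node of type $t_1\in\{T,J\}$ (transmitter, jammer) has power $P_{t_1}>0$; a node of type $t\in\{T,J,R,W\}$ (also: receiver, wiretapper) has main-lobe width $\theta_t\in[0,2\pi]$ and main- and side-lobe gains $G_M^t,G_S^t>0$. Independently of its status and fading, a link from type $t_1\in\{T,J\}$ to type $t_2\in\{R,W\}$ has antenna gain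 $\mathsf G=G_i^{t_1}G_j^{t_2}$, $i,j\in\{M,S\}$, with probability $p^{t_1t_2}_{ij}=q_i(\theta_{t_1})q_j(\theta_{t_2})$, where $q_M(\theta)=\frac{\theta}{2\pi}$ and $q_S(\theta)=\frac{2\pi-\theta}{2\pi}$. Given all locations, the links from the transmitters $x\ne x_0$ to $y_0$ are independent with these laws, and each link from a transmitter to an eavesdropper or from an eavesdropper to a receiver has this law (no joint law of the latter links is needed). An eavesdropper wiretaps if its cost of wiretapping is less than $\rho$ times its cost of jamming ($\rho>0$), and jams otherwise. The cost of wiretapping (jamming) is the minimum over all transmitters (receivers) of the distance $d$ under the DOWJ attack, of the path loss $d^{\alpha}$ under the LOWJ attack, and of $d^{\alpha}/(P_T\mathsf G)$ (respectively $d^{\alpha}/(P_J\mathsf G)$) under the POWJ attack. Let $$I_{y_0}^T=\sum_{x\in\Phi_T\setminus\{x_0\}}P_T\,\mathsf G^{x,y_0}_{T,R}\,h_{x,y_0}\,d_{x,y_0}^{-\alpha}\in[0,\infty]$$ be the interference at $y_0$ from the other transmitters, let $\mathcal L_{y_0}^T(s)=\mathbb E[e^{-sI_{y_0}^T}]$ (with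 $e^{-\infty}=0$ and $0\cdot\infty=0$), and let $$\Omega_{T,R}(s,r)=\sum_{k\in\{L,N\}}\ \sum_{i,j\in\{M,S\}}p^{TR}_{ij}\,p_k(r)\left(1-\Big(1+\frac{sP_TG_i^TG_j^R}{N_kr^{\alpha_k}}\Big)^{-N_k}\right).$$ **Statement.** Under each of the DOWJ, LOWJ and POWJ attacks, for every $s\ge 0$, $$\mathcal L_{y_0}^T(s)=\exp\left(-2\pi\lambda\int_0^\infty\Omega_{T,R}(s,r)\,r\,dr\right),$$ where the integral of the nonnegative integrand takes its value in $[0,\infty]$. If $\alpha_N>2$, then moreover $I_{y_0}^T<\infty$ almost surely and the integral is finite for every $s\ge0$, so that this is an identity between ordinary real expressions. -/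

import Mathlib

open MeasureTheory ProbabilityTheory Set
open scoped ENNReal NNReal

noncomputable section

namespace OWJ

/-- The Euclidean plane. -/
abbrev Plane : Type := EuclideanSpace ℝ (Fin 2)

/-- Status of a link: line of sight or blocked. -/
inductive Status
  | LoS
  | NLoS
  deriving DecidableEq

/-- The two lobes of a sectored antenna. -/
inductive Lobe
  | main
  | side
  deriving DecidableEq

/-- Transmitting node types: (legitimate) transmitter or jammer. -/
inductive TxKind
  | T
  | J
  deriving DecidableEq

/-- Receiving node types: (legitimate) receiver or wiretapper. -/
inductive RxKind
  | R
  | W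
  deriving DecidableEq

/-- The three realizations of the opportunistic wiretapping and jamming attack. -/
inductive Attack
  | DOWJ
  | LOWJ
  | POWJ
  deriving DecidableEq

instance : Fintype Status := ⟨{Status.LoS, Status.NLoS}, fun k => by cases k <;> simp⟩
instance : Fintype Lobe := ⟨{Lobe.main, Lobe.side}, fun i => by cases i <;> simp⟩
instance : MeasurableSpace Status := ⊤
instance : MeasurableSpace Lobe := ⊤

/-- State of a link: (status, lobe used by the sender, lobe used by the addressee) and the
channel gain. -/
abbrev Link : Type := (Status × Lobe × Lobe) × ℝ

/-- Parameters of the network and their ranges. -/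
structure Params where
  /-- intensity of transmitters and of receivers -/
  lam : ℝ
  lam_pos : 0 < lam
  /-- intensity of eavesdroppers -/
  lamE : ℝ
  lamE_pos : 0 < lamE
  /-- distance of the typical transmitter-receiver pair -/
  r₀ : ℝ
  r₀_pos : 0 < r₀
  /-- blockage density -/
  beta : ℝ
  beta_pos : 0 < beta
  /-- bias of the eavesdroppers towards wiretapping -/
  rho : ℝ
  rho_pos : 0 < rho
  /-- transmit power and jamming power -/
  power : TxKind → ℝ
  power_pos : ∀ t, 0 < power t
  /-- main lobe width and antenna gains, sending nodes -/
  txWidth : TxKind → ℝ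
  txWidth_mem : ∀ t, txWidth t ∈ Icc 0 (2 * Real.pi)
  txGain : TxKind → Lobe → ℝ
  txGain_pos : ∀ t i, 0 < txGain t i
  /-- main lobe width and antenna gains, receiving nodes -/
  rxWidth : RxKind → ℝ
  rxWidth_mem : ∀ t, rxWidth t ∈ Icc 0 (2 * Real.pi)
  rxGain : RxKind → Lobe → ℝ
  rxGain_pos : ∀ t i, 0 < rxGain t i
  /-- path-loss exponents -/
  alpha : Status → ℝ
  alpha_pos : 0 < alpha Status.LoS
  alpha_lt : alpha Status.LoS < alpha Status.NLoS
  /-- Nakagami fading parameters -/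
  nak : Status → ℕ
  nak_pos : 0 < nak Status.NLoS
  nak_lt : nak Status.NLoS < nak Status.LoS

namespace Params

variable (p : Params)

/-- Probability that an isotropically oriented antenna with main lobe width `θ` shows the given
lobe. -/
def lobeProb (θ : ℝ) : Lobe → ℝ
  | Lobe.main => θ / (2 * Real.pi)
  | Lobe.side => (2 * Real.pi - θ) / (2 * Real.pi)

/-- The probability `p_{ij}^{t₁t₂}` of the antenna gain `G_i^{t₁} G_j^{t₂}`. -/
def gainProb (t₁ : TxKind) (t₂ : RxKind) (i j : Lobe) : ℝ :=
  lobeProb (p.txWidth t₁) i * lobeProb (p.rxWidth t₂) j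

/-- The probability `p_k(r)` that a link of length `r` has status `k`. -/
def statusProb (r : ℝ) : Status → ℝ
  | Status.LoS => Real.exp (-p.beta * r)
  | Status.NLoS => 1 - Real.exp (-p.beta * r)

/-- `Ω_{t₁,t₂}^{k,i,j}(s,r)`. -/
def OmegaKIJ (t₁ : TxKind) (t₂ : RxKind) (k : Status) (i j : Lobe) (s r : ℝ) : ℝ :=
  p.gainProb t₁ t₂ i j * p.statusProb r k *
    (1 - (1 + s * p.power t₁ * p.txGain t₁ i * p.rxGain t₂ j /
      (p.nak k * r ^ p.alpha k)) ^ (-(p.nak k : ℤ)))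

/-- `Ω_{t₁,t₂}^{k}(s,r)`. -/
def OmegaK (t₁ : TxKind) (t₂ : RxKind) (k : Status) (s r : ℝ) : ℝ :=
  ∑ i, ∑ j, p.OmegaKIJ t₁ t₂ k i j s r

/-- `Ω_{t₁,t₂}(s,r)`. -/
def Omega (t₁ : TxKind) (t₂ : RxKind) (s r : ℝ) : ℝ :=
  ∑ k, p.OmegaK t₁ t₂ k s r

/-- The law of the state of a link of length `d` from a node of type `t₁` to a node of type `t₂`:
status and lobes are independent, and given them the channel gain is gamma distributed with shape
and rate both equal to the Nakagami parameter of the status. -/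
def linkLaw (t₁ : TxKind) (t₂ : RxKind) (d : ℝ) : Measure Link :=
  ∑ k, ∑ i, ∑ j, ENNReal.ofReal (p.statusProb d k * p.gainProb t₁ t₂ i j) •
    (Measure.dirac (k, i, j)).prod (gammaMeasure (p.nak k) (p.nak k))

/-- Path loss `d ^ α` over distance `d` on a link in state `l`. -/
def pathLoss (d : ℝ) (l : Link) : ℝ := d ^ p.alpha l.1.1

/-- Effective antenna gain of a link in state `l`. -/
def antennaGain (t₁ : TxKind) (t₂ : RxKind) (l : Link) : ℝ :=
  p.txGain t₁ l.1.2.1 * p.rxGain t₂ l.1.2.2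

/-- Power received over distance `d` on a link in state `l`. -/
def receivedPower (t₁ : TxKind) (t₂ : RxKind) (d : ℝ) (l : Link) : ℝ :=
  p.power t₁ * p.antennaGain t₁ t₂ l * l.2 * d ^ (-p.alpha l.1.1)

end Params

/-- The random elements of the network around a typical pair `x₀ → y₀`. The typical receiver is at
the fixed point `y₀`; the transmitters other than `x₀`, the receivers other than `y₀` and the
eavesdroppers are enumerated by `ℕ`. In link families `none` stands for the member `x₀` or `y₀` of
the typical pair. -/
structure Network (Ω : Type*) where
  /-- location of the typical receiver -/
  y₀ : Plane
  /-- direction of the typical transmitter as seen from the typical receiver -/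
  angle : Ω → ℝ
  /-- locations of the other transmitters -/
  tx : ℕ → Ω → Plane
  /-- locations of the other receivers -/
  rx : ℕ → Ω → Plane
  /-- locations of the eavesdroppers -/
  eve : ℕ → Ω → Plane
  /-- links from the other transmitters to `y₀` -/
  linkTY : ℕ → Ω → Link
  /-- links from transmitters to eavesdroppers -/
  linkTE : Option ℕ → ℕ → Ω → Link
  /-- links from eavesdroppers to receivers -/
  linkER : ℕ → Option ℕ → Ω → Link

/-- The enumerated points `X 0, X 1, …` form a Poisson point process with intensity measure `ν`:
the number of points in a set of finite measure is Poisson distributed, and the numbers of points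
in finitely many pairwise disjoint such sets are independent. -/
structure IsPoissonProcess {Ω E : Type*} [MeasurableSpace Ω] [MeasurableSpace E]
    (P : Measure Ω) (ν : Measure E) (X : ℕ → Ω → E) : Prop where
  measurable : ∀ n, Measurable (X n)
  law : ∀ B : Set E, MeasurableSet B → ν B ≠ ∞ → ∀ k : ℕ,
    P {ω | {n | X n ω ∈ B}.encard = k} = poissonMeasure (ν B).toNNReal {k}
  indep : ∀ (m : ℕ) (B : Fin m → Set E), (∀ i, MeasurableSet (B i)) → (∀ i, ν (B i) ≠ ∞) →
    Pairwise (Function.onFun Disjoint B) →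
    iIndepFun (fun i ω => {n | X n ω ∈ B i}.encard) P

/-- Given the σ-algebra `m`, the random elements `Y i` are independent with laws `κ i ω`. -/
def IsCondIndepWithLaw {Ω ι M : Type*} {mΩ : MeasurableSpace Ω} [MeasurableSpace M]
    (P : Measure Ω) (m : MeasurableSpace Ω) (Y : ι → Ω → M) (κ : ι → Ω → Measure M) : Prop :=
  ∀ (F : Finset ι) (A : ι → Set M), (∀ i, MeasurableSet (A i)) →
    P⟦⋂ i ∈ F, Y i ⁻¹' A i | m⟧ =ᵐ[P] fun ω => ∏ i ∈ F, (κ i ω).real (A i)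

/-- Given the σ-algebra `m`, the random element `Y` has law `κ ω`. -/
def HasCondLaw {Ω M : Type*} {mΩ : MeasurableSpace Ω} [MeasurableSpace M]
    (P : Measure Ω) (m : MeasurableSpace Ω) (Y : Ω → M) (κ : Ω → Measure M) : Prop :=
  ∀ A : Set M, MeasurableSet A → P⟦Y ⁻¹' A | m⟧ =ᵐ[P] fun ω => (κ ω).real A

namespace Network

variable {Ω : Type*} (net : Network Ω) (p : Params)

/-- All transmitters; `none` is the typical one, at distance `r₀` from `y₀`. -/
def txAll : Option ℕ → Ω → Plane
  | none, ω => net.y₀ + !₂[p.r₀ * Real.cos (net.angle ω), p.r₀ * Real.sin (net.angle ω)]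
  | some n, ω => net.tx n ω

/-- All receivers; `none` is the typical one. -/
def rxAll : Option ℕ → Ω → Plane
  | none, _ => net.y₀
  | some n, ω => net.rx n ω

/-- All random locations together. -/
def locations (ω : Ω) : (((ℕ → Plane) × (ℕ → Plane)) × (ℕ → Plane)) × ℝ :=
  (((fun n => net.tx n ω, fun n => net.rx n ω), fun n => net.eve n ω), net.angle ω)

/-- The σ-algebra generated by all random locations. -/
abbrev locSigma : MeasurableSpace Ω := MeasurableSpace.comap net.locations inferInstance

/-- The cost of wiretapping for the eavesdropper `z`. -/
def wiretapCost (a : Attack) (z : ℕ) (ω : Ω) : ℝ :=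
  ⨅ x : Option ℕ,
    let d := dist (net.txAll p x ω) (net.eve z ω)
    let l := net.linkTE x z ω
    match a with
    | Attack.DOWJ => d
    | Attack.LOWJ => p.pathLoss d l
    | Attack.POWJ => p.pathLoss d l / (p.power TxKind.T * p.antennaGain TxKind.T RxKind.W l)

/-- The cost of jamming for the eavesdropper `z`. -/
def jamCost (a : Attack) (z : ℕ) (ω : Ω) : ℝ :=
  ⨅ y : Option ℕ,
    let d := dist (net.eve z ω) (net.rxAll y ω)
    let l := net.linkER z y ω
    match a with
    | Attack.DOWJ => d
    | Attack.LOWJ => p.pathLoss d l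
    | Attack.POWJ => p.pathLoss d l / (p.power TxKind.J * p.antennaGain TxKind.J RxKind.R l)

/-- The eavesdropper `z` wiretaps if wiretapping is cheaper than `ρ` times jamming, and jams
otherwise. -/
def IsJammer (a : Attack) (z : ℕ) (ω : Ω) : Prop :=
  ¬ net.wiretapCost p a z ω < p.rho * net.jamCost p a z ω

open Classical in
/-- The interference `I_{y₀}^{t}` at the typical receiver under the attack `a`: for `t = T` from
the transmitters other than `x₀`, for `t = J` from the jammers. -/
def interference (a : Attack) : TxKind → Ω → ℝ≥0∞
  | TxKind.T, ω => ∑' n, ENNReal.ofReal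
      (p.receivedPower TxKind.T RxKind.R (dist (net.tx n ω) net.y₀) (net.linkTY n ω))
  | TxKind.J, ω => ∑' z, if net.IsJammer p a z ω then ENNReal.ofReal
      (p.receivedPower TxKind.J RxKind.R (dist (net.eve z ω) net.y₀) (net.linkER z none ω)) else 0

/-- The probabilistic model of the network. Given all locations, the states of the links from the
interfering transmitters to `y₀` are independent and have the link law of their length; so has each
link to or from an eavesdropper, where no joint law is prescribed, since links of one eavesdropper
share its antenna. -/
structure IsModel [mΩ : MeasurableSpace Ω] (P : Measure Ω) : Prop where
  measurable_angle : Measurable net.angle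
  uniform_angle : pdf.IsUniform net.angle (Ioc 0 (2 * Real.pi)) P volume
  poisson_tx : IsPoissonProcess P (ENNReal.ofReal p.lam • volume) net.tx
  poisson_rx : IsPoissonProcess P (ENNReal.ofReal p.lam • volume) net.rx
  poisson_eve : IsPoissonProcess P (ENNReal.ofReal p.lamE • volume) net.eve
  indep_tx_rx : IndepFun (fun ω n => net.tx n ω) (fun ω n => net.rx n ω) P
  indep_eve : IndepFun (fun ω => (net.locations ω).1.1) (fun ω n => net.eve n ω) P
  indep_angle : IndepFun (fun ω => (net.locations ω).1) net.angle P
  measurable_linkTY : ∀ n, Measurable (net.linkTY n)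
  measurable_linkTE : ∀ x z, Measurable (net.linkTE x z)
  measurable_linkER : ∀ z y, Measurable (net.linkER z y)
  linkTY_law : IsCondIndepWithLaw P net.locSigma net.linkTY
    (fun n ω => p.linkLaw TxKind.T RxKind.R (dist (net.tx n ω) net.y₀))
  linkTE_law : ∀ x z, HasCondLaw P net.locSigma (net.linkTE x z)
    (fun ω => p.linkLaw TxKind.T RxKind.W (dist (net.txAll p x ω) (net.eve z ω)))
  linkER_law : ∀ z y, HasCondLaw P net.locSigma (net.linkER z y)
    (fun ω => p.linkLaw TxKind.J RxKind.R (dist (net.eve z ω) (net.rxAll y ω)))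

end Network

/-- `e ^ (-x)` for `x ∈ [0, ∞]`, with `e ^ (-∞) = 0`. -/
def expNeg (x : ℝ≥0∞) : ℝ := if x = ∞ then 0 else Real.exp (-x.toReal)

/-- The Laplace transform `s ↦ E[e ^ (-s X)]`, `s ≥ 0`, of a `[0, ∞]`-valued random variable. -/
def laplaceTransform {Ω : Type*} [MeasurableSpace Ω] (P : Measure Ω) (X : Ω → ℝ≥0∞) (s : ℝ) : ℝ :=
  ∫ ω, expNeg (ENNReal.ofReal s * X ω) ∂P

end OWJ

end

open Filter Topology

/-! Given all locations, the links to `y₀` are independent, so the conditional Laplace transform of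
a finite partial sum of the interference is a product of one factor per transmitter. Averaging the
gamma fading, the lobes and the status over a link of length r > 0 makes this factor g(r) = 1 -
Ω(s,r). Letting the number of transmitters grow, by dominated convergence with all products in
[0,1], turns the Laplace transform into E ∏ g(|x - y₀|) over the Poisson points x. With g = e^{-u},
the Laplace functional of a Poisson process evaluates this as exp(-λ ∫ (1 - g(|x - y₀|)) dx), and
polar coordinates produce 2πλ ∫ Ω(s,r) r dr. The attack plays no part, since it only affects which
eavesdroppers jam.

The carriers are `IsPoissonProcess.lintegral_eexpNeg_tsum` (Laplace functional),
`IsCondIndepWithLaw.lintegral_prod` (integrating out the links) and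
`Params.lintegral_eexpNeg_receivedPower` (one link). All of this takes place in [0,∞] with e^{-∞} =
0, so no finiteness is needed along the way.

If α_N > 2, Ω(s,r) r is integrable: line of sight is lost exponentially fast, and the blocked part
decays like r^{1-α_N}. Since e^{-sI} vanishes on I = ∞ for s > 0, P(I < ∞) ≥ E e^{-sI}, and the
formula shows that the right side tends to 1 as s → 0. -/

namespace OWJ

/-! ### The function e^{-x} on [0,∞] -/

/-- The `[0, ∞]`-valued version of `expNeg`. -/
noncomputable def eexpNeg (x : ℝ≥0∞) : ℝ≥0∞ := EReal.exp (-(x : EReal))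

lemma eexpNeg_top : eexpNeg ∞ = 0 := by simp [eexpNeg]

lemma eexpNeg_zero : eexpNeg 0 = 1 := by simp [eexpNeg]

lemma eexpNeg_ofReal {x : ℝ} (hx : 0 ≤ x) :
    eexpNeg (ENNReal.ofReal x) = ENNReal.ofReal (Real.exp (-x)) := by
  rw [eexpNeg, EReal.coe_ennreal_ofReal, max_eq_left hx, ← EReal.coe_neg, EReal.exp_coe]

lemma ofReal_expNeg (x : ℝ≥0∞) : ENNReal.ofReal (expNeg x) = eexpNeg x := by
  by_cases hx : x = ∞
  · simp [expNeg, hx, eexpNeg_top]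
  · conv_rhs => rw [← ENNReal.ofReal_toReal hx]
    rw [expNeg, if_neg hx, eexpNeg_ofReal ENNReal.toReal_nonneg]

lemma expNeg_nonneg (x : ℝ≥0∞) : 0 ≤ expNeg x := by
  unfold expNeg; split_ifs <;> positivity

lemma expNeg_eq_toReal (x : ℝ≥0∞) : expNeg x = (eexpNeg x).toReal := by
  rw [← ofReal_expNeg, ENNReal.toReal_ofReal (expNeg_nonneg x)]

lemma continuous_eexpNeg : Continuous eexpNeg :=
  ENNReal.continuous_exp.comp (continuous_neg.comp continuous_coe_ennreal_ereal)

lemma measurable_eexpNeg : Measurable eexpNeg := continuous_eexpNeg.measurable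

lemma antitone_eexpNeg : Antitone eexpNeg := fun _ _ h =>
  EReal.exp_monotone (EReal.neg_le_neg_iff.2 (EReal.coe_ennreal_le_coe_ennreal_iff.2 h))

lemma eexpNeg_le_one (x : ℝ≥0∞) : eexpNeg x ≤ 1 :=
  eexpNeg_zero ▸ antitone_eexpNeg zero_le

lemma eexpNeg_ne_top (x : ℝ≥0∞) : eexpNeg x ≠ ∞ :=
  ((eexpNeg_le_one x).trans_lt ENNReal.one_lt_top).ne

lemma eexpNeg_add (x y : ℝ≥0∞) : eexpNeg (x + y) = eexpNeg x * eexpNeg y := by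
  by_cases hx : x = ∞
  · simp [hx, eexpNeg_top]
  by_cases hy : y = ∞
  · simp [hy, eexpNeg_top]
  rw [← ENNReal.ofReal_toReal hx, ← ENNReal.ofReal_toReal hy,
    ← ENNReal.ofReal_add ENNReal.toReal_nonneg ENNReal.toReal_nonneg,
    eexpNeg_ofReal (by positivity), eexpNeg_ofReal ENNReal.toReal_nonneg,
    eexpNeg_ofReal ENNReal.toReal_nonneg, ← ENNReal.ofReal_mul (by positivity), neg_add,
    Real.exp_add]

lemma eexpNeg_sum {ι : Type*} (s : Finset ι) (f : ι → ℝ≥0∞) :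
    eexpNeg (∑ i ∈ s, f i) = ∏ i ∈ s, eexpNeg (f i) := by
  induction s using Finset.cons_induction with
  | empty => simp [eexpNeg_zero]
  | cons a s ha ih => rw [Finset.sum_cons, Finset.prod_cons, eexpNeg_add, ih]

lemma eexpNeg_mul_natCast (c : ℝ≥0∞) (k : ℕ) : eexpNeg (c * k) = eexpNeg c ^ k := by
  have := eexpNeg_sum (Finset.range k) fun _ => c
  rwa [Finset.sum_const, Finset.prod_const, Finset.card_range, nsmul_eq_mul, mul_comm] at this

/-- Every element of `[0, 1]` is of the form `e ^ (-x)`. -/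
lemma eexpNeg_neg_log {g : ℝ≥0∞} (hg : g ≤ 1) : eexpNeg (-ENNReal.log g).toENNReal = g := by
  have h : 0 ≤ -ENNReal.log g := by
    rw [EReal.neg_nonneg, ← ENNReal.log_one]
    exact ENNReal.log_monotone hg
  rw [eexpNeg, EReal.coe_toENNReal h, neg_neg, ENNReal.exp_log]

/-- Continuity of `eexpNeg` at ∞ is what covers divergent sums, whose products tend to 0. -/
lemma tendsto_eexpNeg_sum_range (f : ℕ → ℝ≥0∞) :
    Tendsto (fun N => ∏ n ∈ Finset.range N, eexpNeg (f n)) atTop (𝓝 (eexpNeg (∑' n, f n))) := by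
  simp_rw [← eexpNeg_sum]
  exact (continuous_eexpNeg.tendsto _).comp ENNReal.summable.hasSum.tendsto_sum_nat

/-! ### Laplace functional of a Poisson point process -/

/-- The Laplace transform of a Poisson distribution. -/
lemma lintegral_eexpNeg_poissonMeasure (r : ℝ≥0) (c : ℝ≥0∞) :
    ∫⁻ k, eexpNeg (c * k) ∂(poissonMeasure r) = eexpNeg (r * (1 - eexpNeg c)) := by
  obtain ⟨q, hq0, hq1, hq⟩ : ∃ q : ℝ, 0 ≤ q ∧ q ≤ 1 ∧ eexpNeg c = ENNReal.ofReal q :=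
    ⟨(eexpNeg c).toReal, ENNReal.toReal_nonneg, ENNReal.toReal_le_of_le_ofReal zero_le_one
      (by simpa using eexpNeg_le_one c), (ENNReal.ofReal_toReal (eexpNeg_ne_top c)).symm⟩
  -- The exponential series ∑ e^{-r} (rq)^k / k! = e^{-r(1-q)}. The case c = ∞ is q = 0, where 0^0 =
  -- 1 matches ∞ · 0 = 0.
  have hs : HasSum (fun k : ℕ => q ^ k * (Real.exp (-r) * r ^ k / k.factorial))
      (Real.exp (-(r * (1 - q)))) := by
    have h := (NormedSpace.expSeries_div_hasSum_exp (𝔸 := ℝ) (r * q)).mul_left (Real.exp (-r))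
    rw [← Real.exp_eq_exp_ℝ, ← Real.exp_add] at h
    convert! h using 1
    · ext k; rw [mul_pow]; ring
    · congr 1; ring
  have hr : (r : ℝ≥0∞) * (1 - ENNReal.ofReal q) = ENNReal.ofReal (r * (1 - q)) := by
    rw [ENNReal.ofReal_mul r.coe_nonneg, ENNReal.ofReal_sub _ hq0]; simp
  rw [lintegral_countable', hq, hr, eexpNeg_ofReal (mul_nonneg r.coe_nonneg (by linarith)),
    ← hs.tsum_eq,
    ENNReal.ofReal_tsum_of_nonneg (fun k => by positivity) hs.summable]
  congr with k
  rw [eexpNeg_mul_natCast, hq, poissonMeasure_singleton, ENNReal.ofReal_mul (by positivity),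
    ENNReal.ofReal_pow hq0]

namespace IsPoissonProcess

variable {Ω E : Type*} [MeasurableSpace Ω] [MeasurableSpace E] {P : Measure Ω}
  {ν : Measure E} {X : ℕ → Ω → E}

lemma measurable_count (hX : IsPoissonProcess P ν X) {B : Set E} (hB : MeasurableSet B) :
    Measurable fun ω => {n | X n ω ∈ B}.encard := by
  refine measurable_encard.comp (measurable_set_iff.2 fun n => ?_)
  exact (measurable_mem.2 hB).comp (hX.measurable n)

/-- The field `law` only prescribes the probabilities of finite counts. They already sum to 1, so no
mass is left for the value ∞. -/
lemma map_count [IsProbabilityMeasure P] (hX : IsPoissonProcess P ν X) {B : Set E}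
    (hB : MeasurableSet B) (hν : ν B ≠ ∞) :
    P.map (fun ω => {n | X n ω ∈ B}.encard) =
      (poissonMeasure (ν B).toNNReal).map (Nat.cast : ℕ → ℕ∞) := by
  have hm := hX.measurable_count hB
  have hc : MeasurableEmbedding (Nat.cast : ℕ → ℕ∞) :=
    ⟨Nat.cast_injective, .of_discrete, fun _ _ => .of_discrete⟩
  have h : poissonMeasure (ν B).toNNReal =
      (P.map fun ω => {n | X n ω ∈ B}.encard).comap (Nat.cast : ℕ → ℕ∞) := by
    refine Measure.ext_of_singleton fun k => ?_
    rw [hc.comap_apply, image_singleton, Measure.map_apply hm (.of_discrete), ← hX.law B hB hν k]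
    rfl
  have := Measure.isProbabilityMeasure_map (μ := P) hm.aemeasurable
  have := Measure.isProbabilityMeasure_map (μ := poissonMeasure (ν B).toNNReal)
    hc.measurable.aemeasurable
  -- The image of the Poisson law is the law of the count restricted to finite values, hence is
  -- dominated by it; two probability measures so ordered coincide.
  refine (Measure.eq_of_le_of_measure_univ_eq ?_ (by simp only [measure_univ])).symm
  rw [h, hc.map_comap]
  exact Measure.restrict_le_self

lemma lintegral_eexpNeg_count [IsProbabilityMeasure P] (hX : IsPoissonProcess P ν X) {B : Set E}
    (hB : MeasurableSet B) (hν : ν B ≠ ∞) (c : ℝ≥0∞) :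
    ∫⁻ ω, eexpNeg (c * {n | X n ω ∈ B}.encard) ∂P = eexpNeg (ν B * (1 - eexpNeg c)) := by
  have h := lintegral_eexpNeg_poissonMeasure (ν B).toNNReal c
  rw [ENNReal.coe_toNNReal hν] at h
  rw [← h, ← lintegral_map (f := fun k : ℕ∞ => eexpNeg (c * k)) .of_discrete
    (hX.measurable_count hB), hX.map_count hB hν, lintegral_map .of_discrete .of_discrete]
  simp

lemma lintegral_eexpNeg_sum_count [IsProbabilityMeasure P] (hX : IsPoissonProcess P ν X)
    {ι : Type*} [Fintype ι] {B : ι → Set E} (hB : ∀ i, MeasurableSet (B i))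
    (hν : ∀ i, ν (B i) ≠ ∞) (hd : Pairwise (Function.onFun Disjoint B)) (c : ι → ℝ≥0∞) :
    ∫⁻ ω, eexpNeg (∑ i, c i * {n | X n ω ∈ B i}.encard) ∂P =
      eexpNeg (∑ i, ν (B i) * (1 - eexpNeg (c i))) := by
  have e := Fintype.equivFin ι
  have hi : iIndepFun (fun i ω => {n | X n ω ∈ B i}.encard) P := by
    have := (hX.indep _ (B ∘ e.symm) (fun i => hB _) (fun i => hν _)
      (hd.comp_of_injective e.symm.injective)).precomp e.injective
    simpa using this
  have hi' := hi.comp (fun i (k : ℕ∞) => eexpNeg (c i * k)) fun _ => .of_discrete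
  simp_rw [eexpNeg_sum, ← hX.lintegral_eexpNeg_count (hB _) (hν _)]
  refine lintegral_prod_eq_prod_lintegral_of_indepFun Finset.univ
    (fun i ω => eexpNeg (c i * {n | X n ω ∈ B i}.encard)) hi' fun i => ?_
  exact (Measurable.of_discrete (f := fun k : ℕ∞ => eexpNeg (c i * k))).comp
    (hX.measurable_count (hB i))

/-- Grouping the points by the value of `f` turns the sum into a combination of counts in the
disjoint fibres. The value 0 is left out because its fibre may have infinite measure. -/
lemma lintegral_eexpNeg_tsum_simpleFunc [IsProbabilityMeasure P] (hX : IsPoissonProcess P ν X)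
    (f : SimpleFunc E ℝ≥0∞) (hf : f.FinMeasSupp ν) :
    ∫⁻ ω, eexpNeg (∑' n, f (X n ω)) ∂P = eexpNeg (∫⁻ x, (1 - eexpNeg (f x)) ∂ν) := by
  classical
  let s := f.range.filter (· ≠ 0)
  have hs : ∀ i : s, (i : ℝ≥0∞) ≠ 0 := fun i => (Finset.mem_filter.1 i.2).2
  have key := hX.lintegral_eexpNeg_sum_count (ι := s) (B := fun i => f ⁻¹' {(i : ℝ≥0∞)})
    (fun i => f.measurableSet_fiber _)
    (fun i => (SimpleFunc.finMeasSupp_iff.1 hf _ (hs i)).ne)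
    (fun i j hij => Disjoint.preimage _ (disjoint_singleton.2 (Subtype.coe_injective.ne hij)))
    (fun i => i)
  -- Needed twice: with F the identity for the sum over points, and with F(y) = 1 - e^{-y} for the
  -- integral.
  have hsum : ∀ (F : ℝ≥0∞ → ℝ≥0∞), F 0 = 0 → ∀ x,
      F (f x) = ∑ i : s, F i * (f ⁻¹' {(i : ℝ≥0∞)}).indicator 1 x := by
    intro F hF x
    rw [Finset.sum_coe_sort s fun i => F i * (f ⁻¹' {i}).indicator (1 : E → ℝ≥0∞) x]
    by_cases h0 : f x = 0
    · rw [h0, hF, Finset.sum_eq_zero]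
      intro i hi
      have : f x ≠ i := h0 ▸ (Finset.mem_filter.1 hi).2.symm
      simp [this]
    · rw [Finset.sum_eq_single (f x)]
      · simp
      · intro i _ hi
        simp [hi.symm]
      · intro h
        exact absurd (Finset.mem_filter.2 ⟨f.mem_range_self x, h0⟩) h
  convert! key using 3 with ω
  · congr 1
    have hid : ∀ x, f x = ∑ i : s, (i : ℝ≥0∞) * (f ⁻¹' {(i : ℝ≥0∞)}).indicator 1 x :=
      hsum id rfl
    simp_rw [fun n => hid (X n ω)]
    rw [Summable.tsum_finsetSum fun _ _ => ENNReal.summable]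
    refine Finset.sum_congr rfl fun i _ => ?_
    rw [ENNReal.tsum_mul_left, ← ENNReal.tsum_set_one,
      tsum_subtype {n | X n ω ∈ f ⁻¹' {(i : ℝ≥0∞)}} fun _ => (1 : ℝ≥0∞)]
    rfl
  · have h1 := hsum (fun y => 1 - eexpNeg y) (by simp [eexpNeg_zero])
    rw [lintegral_congr h1]
    rw [lintegral_finsetSum _ fun i _ => (measurable_one.indicator
      (f.measurableSet_fiber _)).const_mul _]
    refine Finset.sum_congr rfl fun i _ => ?_
    rw [lintegral_const_mul _ (measurable_one.indicator (f.measurableSet_fiber _)),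
      lintegral_indicator_one (f.measurableSet_fiber _), mul_comm]

/-- The Laplace functional of a Poisson point process. -/
theorem lintegral_eexpNeg_tsum [IsProbabilityMeasure P] [SigmaFinite ν]
    (hX : IsPoissonProcess P ν X) {u : E → ℝ≥0∞} (hu : Measurable u) :
    ∫⁻ ω, eexpNeg (∑' n, u (X n ω)) ∂P = eexpNeg (∫⁻ x, (1 - eexpNeg (u x)) ∂ν) := by
  -- Cutting the simple approximations off to spanning sets gives them support of finite measure and
  -- keeps them increasing to `u`.
  let f : ℕ → SimpleFunc E ℝ≥0∞ := fun k => (SimpleFunc.eapprox u k).restrict (spanningSets ν k)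
  have hfa : ∀ k x, f k x = (spanningSets ν k).indicator (SimpleFunc.eapprox u k) x := fun k x =>
    SimpleFunc.restrict_apply _ (measurableSet_spanningSets ν k) x
  have hmono : ∀ x, Monotone fun k => f k x := by
    intro x i j hij
    simp only [hfa]
    exact (indicator_le_indicator (SimpleFunc.monotone_eapprox u hij x)).trans
      (indicator_le_indicator_of_subset (monotone_spanningSets ν hij) (fun _ => zero_le) x)
  have hlim : ∀ x, Tendsto (fun k => f k x) atTop (𝓝 (u x)) := by
    intro x
    refine (SimpleFunc.tendsto_eapprox hu x).congr' ?_
    filter_upwards [eventually_ge_atTop (spanningSetsIndex ν x)] with k hk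
    rw [hfa, indicator_of_mem (mem_spanningSets_of_index_le ν x hk)]
  have hfin : ∀ k, (f k).FinMeasSupp ν := by
    intro k
    rw [SimpleFunc.finMeasSupp_iff_support]
    refine (measure_mono ?_).trans_lt (measure_spanningSets_lt_top ν k)
    intro x hx
    by_contra h
    exact hx (by rw [hfa, indicator_of_notMem h])
  have hE := fun k => hX.lintegral_eexpNeg_tsum_simpleFunc (f k) (hfin k)
  have hm : ∀ {v : E → ℝ≥0∞}, Measurable v → Measurable fun ω => eexpNeg (∑' n, v (X n ω)) :=
    fun hv => measurable_eexpNeg.comp (Measurable.tsum fun n => hv.comp (hX.measurable n))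
  have h1 : Tendsto (fun k => ∫⁻ ω, eexpNeg (∑' n, f k (X n ω)) ∂P) atTop
      (𝓝 (∫⁻ ω, eexpNeg (∑' n, u (X n ω)) ∂P)) := by
    refine tendsto_lintegral_of_dominated_convergence 1 (fun k => hm (f k).measurable)
      (fun k => .of_forall fun ω => eexpNeg_le_one _) (by simp) (.of_forall fun ω => ?_)
    refine (continuous_eexpNeg.tendsto _).comp ?_
    -- The sum over points is an integral against counting measure, so monotone convergence applies
    -- for each outcome.
    simp_rw [← lintegral_count]
    exact lintegral_tendsto_of_tendsto_of_monotone (fun k => Measurable.of_discrete.aemeasurable)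
      (.of_forall fun n => hmono _) (.of_forall fun n => hlim _)
  have h2 : Tendsto (fun k => eexpNeg (∫⁻ x, (1 - eexpNeg (f k x)) ∂ν)) atTop
      (𝓝 (eexpNeg (∫⁻ x, (1 - eexpNeg (u x)) ∂ν))) := by
    refine (continuous_eexpNeg.tendsto _).comp ?_
    refine lintegral_tendsto_of_tendsto_of_monotone
      (fun k => (measurable_const.sub (measurable_eexpNeg.comp (f k).measurable)).aemeasurable)
      (.of_forall fun x i j hij => tsub_le_tsub_left (antitone_eexpNeg (hmono x hij)) _)
      (.of_forall fun x => ?_)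
    exact ENNReal.Tendsto.sub tendsto_const_nhds ((continuous_eexpNeg.tendsto _).comp (hlim x))
      (.inl ENNReal.one_ne_top)
  simp_rw [hE] at h1
  exact tendsto_nhds_unique h1 h2

end IsPoissonProcess

/-! ### Integrating out conditionally independent random elements -/

namespace IsCondIndepWithLaw

variable {Ω ι D M : Type*} {m mΩ : MeasurableSpace Ω} [MeasurableSpace D] [MeasurableSpace M]
  {P : Measure Ω} [IsProbabilityMeasure P] {Y : ι → Ω → M} {d : ι → Ω → D} {κ : Kernel D M}
  [IsMarkovKernel κ]

lemma measure_inter (h : IsCondIndepWithLaw P m Y fun i ω => κ (d i ω)) (hm : m ≤ mΩ)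
    (hY : ∀ i, Measurable (Y i)) (S : Finset ι) {A : ι → Set M} (hA : ∀ i, MeasurableSet (A i))
    {C : Set Ω} (hC : MeasurableSet[m] C) :
    P ((⋂ i ∈ S, Y i ⁻¹' A i) ∩ C) = ∫⁻ ω in C, ∏ i ∈ S, κ (d i ω) (A i) ∂P := by
  have hE : MeasurableSet (⋂ i ∈ S, Y i ⁻¹' A i) :=
    S.measurableSet_biInter fun i _ => hY i (hA i)
  have hae := h S A hA
  have hint : Integrable (fun ω => ∏ i ∈ S, (κ (d i ω)).real (A i)) P :=
    integrable_condExp.congr hae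
  have h1 : ∫ ω in C, ∏ i ∈ S, (κ (d i ω)).real (A i) ∂P =
      P.real ((⋂ i ∈ S, Y i ⁻¹' A i) ∩ C) := by
    rw [← integral_congr_ae (ae_restrict_of_ae hae),
      setIntegral_condExp hm ((integrable_const 1).indicator hE) hC, integral_indicator hE,
      setIntegral_const, smul_eq_mul, mul_one, measureReal_restrict_apply hE]
  rw [← ofReal_measureReal, ← h1, ofReal_integral_eq_lintegral_ofReal hint.integrableOn
    (.of_forall fun ω => Finset.prod_nonneg fun i _ => measureReal_nonneg)]
  refine lintegral_congr fun ω => ?_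
  rw [ENNReal.ofReal_prod_of_nonneg fun i _ => measureReal_nonneg]
  exact Finset.prod_congr rfl fun i _ => ofReal_measureReal

lemma lintegral_mul_prod_indicator (h : IsCondIndepWithLaw P m Y fun i ω => κ (d i ω))
    (hm : m ≤ mΩ) (hY : ∀ i, Measurable (Y i)) (hd : ∀ i, Measurable[m] (d i)) (S : Finset ι)
    {A : ι → Set M} (hA : ∀ i, MeasurableSet (A i)) {G : Ω → ℝ≥0∞} (hG : Measurable[m] G) :
    ∫⁻ ω, G ω * ∏ i ∈ S, (A i).indicator 1 (Y i ω) ∂P =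
      ∫⁻ ω, G ω * ∏ i ∈ S, κ (d i ω) (A i) ∂P := by
  have hE : MeasurableSet (⋂ i ∈ S, Y i ⁻¹' A i) :=
    S.measurableSet_biInter fun i _ => hY i (hA i)
  have hK : Measurable fun ω => ∏ i ∈ S, κ (d i ω) (A i) :=
    Finset.measurable_fun_prod _ fun i _ => (κ.measurable_coe (hA i)).comp ((hd i).mono hm le_rfl)
  -- `measure_inter` says that two measures agree on the σ-algebra `m`; they therefore integrate
  -- every `m`-measurable `G` alike.
  have htrim : (P.restrict (⋂ i ∈ S, Y i ⁻¹' A i)).trim hm =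
      (P.withDensity fun ω => ∏ i ∈ S, κ (d i ω) (A i)).trim hm := by
    refine @Measure.ext _ m _ _ fun C hC => ?_
    rw [trim_measurableSet_eq hm hC, trim_measurableSet_eq hm hC,
      Measure.restrict_apply (hm _ hC), withDensity_apply _ (hm _ hC), inter_comm,
      h.measure_inter hm hY S hA hC]
  have hind : ∀ ω, ∏ i ∈ S, (A i).indicator (1 : M → ℝ≥0∞) (Y i ω) =
      (⋂ i ∈ S, Y i ⁻¹' A i).indicator 1 ω := by
    intro ω
    by_cases hω : ω ∈ ⋂ i ∈ S, Y i ⁻¹' A i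
    · rw [indicator_of_mem hω, Pi.one_apply]
      refine Finset.prod_eq_one fun i hi => ?_
      exact indicator_of_mem (s := A i) (mem_iInter₂.1 hω i hi) _
    · rw [indicator_of_notMem hω]
      obtain ⟨i, hi, hω⟩ : ∃ i ∈ S, Y i ω ∉ A i := by simpa using hω
      exact Finset.prod_eq_zero hi (indicator_of_notMem hω _)
  calc ∫⁻ ω, G ω * ∏ i ∈ S, (A i).indicator 1 (Y i ω) ∂P
      = ∫⁻ ω in ⋂ i ∈ S, Y i ⁻¹' A i, G ω ∂P := by
        rw [← lintegral_indicator hE]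
        refine lintegral_congr fun ω => ?_
        rw [hind]
        by_cases hω : ω ∈ ⋂ i ∈ S, Y i ⁻¹' A i
        · rw [indicator_of_mem hω, indicator_of_mem hω, Pi.one_apply, mul_one]
        · rw [indicator_of_notMem hω, indicator_of_notMem hω, mul_zero]
    _ = ∫⁻ ω, G ω ∂(P.withDensity fun ω => ∏ i ∈ S, κ (d i ω) (A i)) := by
        rw [← lintegral_trim hm hG, htrim, lintegral_trim hm hG]
    _ = ∫⁻ ω, G ω * ∏ i ∈ S, κ (d i ω) (A i) ∂P := by
        rw [lintegral_withDensity_eq_lintegral_mul _ hK (hG.mono hm le_rfl)]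
        simp_rw [Pi.mul_apply, mul_comm]

/-- Conditionally independent random elements can be integrated out one by one. -/
lemma lintegral_mul_prod_mul_prod (h : IsCondIndepWithLaw P m Y fun i ω => κ (d i ω))
    (hm : m ≤ mΩ) (hY : ∀ i, Measurable (Y i)) (hd : ∀ i, Measurable[m] (d i))
    {φ : D × M → ℝ≥0∞} (hφ : Measurable φ) (hφ1 : ∀ x, φ x ≤ 1) (T : Finset ι) :
    ∀ (S : Finset ι) (_ : Disjoint S T) (A : ι → Set M) (_ : ∀ i, MeasurableSet (A i))
      (G : Ω → ℝ≥0∞) (_ : Measurable[m] G) (_ : ∀ ω, G ω ≤ 1),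
    ∫⁻ ω, (G ω * ∏ i ∈ S, (A i).indicator 1 (Y i ω)) * ∏ i ∈ T, φ (d i ω, Y i ω) ∂P =
      ∫⁻ ω, (G ω * ∏ i ∈ S, κ (d i ω) (A i)) *
        ∏ i ∈ T, ∫⁻ y, φ (d i ω, y) ∂(κ (d i ω)) ∂P := by
  classical
  have hdm := fun i => (hd i).mono hm le_rfl
  have hg : Measurable fun x => ∫⁻ y, φ (x, y) ∂(κ x) := hφ.lintegral_kernel_prod_right'
  have hg1 : ∀ x, ∫⁻ y, φ (x, y) ∂(κ x) ≤ 1 := fun x =>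
    (lintegral_mono fun y => hφ1 (x, y)).trans (by simp)
  -- The weight `G` and the indicators over `S` are carried for the sake of the induction: they
  -- absorb the test sets used when the next factor, which mixes `d j` and `Y j`, is treated.
  induction T using Finset.induction_on with
  | empty =>
    intro S _ A hA G hG _
    simpa using h.lintegral_mul_prod_indicator hm hY hd S hA hG
  | insert j T hj ih =>
    intro S hS A hA G hG hG1
    rw [Finset.disjoint_insert_right] at hS
    obtain ⟨hjS, hST⟩ := hS
    set H₁ : Ω → ℝ≥0∞ := fun ω =>
      (G ω * ∏ i ∈ S, (A i).indicator 1 (Y i ω)) * ∏ i ∈ T, φ (d i ω, Y i ω) with hH₁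
    set H₂ : Ω → ℝ≥0∞ := fun ω => (G ω * ∏ i ∈ S, κ (d i ω) (A i)) *
      ∏ i ∈ T, ∫⁻ y, φ (d i ω, y) ∂(κ (d i ω)) with hH₂
    have hGm : Measurable G := hG.mono hm le_rfl
    have hH₁m : Measurable H₁ :=
      (hGm.mul (Finset.measurable_fun_prod _ fun i _ =>
        (measurable_one.indicator (hA i)).comp (hY i))).mul
        (Finset.measurable_fun_prod _ fun i _ => hφ.comp ((hdm i).prodMk (hY i)))
    have hH₂m : Measurable H₂ :=
      (hGm.mul (Finset.measurable_fun_prod _ fun i _ =>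
        (κ.measurable_coe (hA i)).comp (hdm i))).mul
        (Finset.measurable_fun_prod _ fun i _ => hg.comp (hdm i))
    have hH₁1 : ∀ ω, H₁ ω ≤ 1 := fun ω =>
      mul_le_one' (mul_le_one' (hG1 ω) (Finset.prod_le_one' fun i _ =>
        indicator_le_self' (fun _ _ => zero_le) _)) (Finset.prod_le_one' fun i _ => hφ1 _)
    have hfin₁ : IsFiniteMeasure (P.withDensity H₁) :=
      isFiniteMeasure_withDensity ((lintegral_mono hH₁1).trans_lt (by simp)).ne
    have hpair : Measurable fun ω => (d j ω, Y j ω) := (hdm j).prodMk (hY j)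
    -- With density `H₁`, the pair (`d j`, `Y j`) has the law built from `d j` under density `H₂`
    -- and the kernel. On a rectangle s × t, the indicator of s joins `G` and that of t joins the
    -- factors over `S`, which reduces the claim to the induction hypothesis.
    have hmeas : (P.withDensity H₁).map (fun ω => (d j ω, Y j ω)) =
        (P.withDensity H₂).map (d j) ⊗ₘ κ := by
      refine Measure.ext_prod fun {s t} hs ht => ?_
      have key := ih (insert j S) (Finset.disjoint_insert_left.2 ⟨hj, hST⟩)
        (Function.update A j t)
        (fun i => by by_cases hij : i = j
                     · subst hij; simpa using ht
                     · simpa [hij] using hA i)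
        (fun ω => G ω * s.indicator 1 (d j ω))
        (hG.mul ((measurable_one.indicator hs).comp (hd j)))
        (fun ω => mul_le_one' (hG1 ω) (indicator_le_self' (fun _ _ => zero_le) _))
      have hκt : Measurable fun ω => κ (d j ω) t := (κ.measurable_coe ht).comp (hdm j)
      have hup : ∀ i ∈ S, Function.update A j t i = A i := fun i hi =>
        Function.update_of_ne (ne_of_mem_of_not_mem hi hjS) _ _
      have e1 : ∀ ω, ∏ i ∈ S, (Function.update A j t i).indicator (1 : M → ℝ≥0∞) (Y i ω) =
          ∏ i ∈ S, (A i).indicator 1 (Y i ω) := fun ω =>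
        Finset.prod_congr rfl fun i hi => by rw [hup i hi]
      have e2 : ∀ ω, ∏ i ∈ S, κ (d i ω) (Function.update A j t i) =
          ∏ i ∈ S, κ (d i ω) (A i) := fun ω =>
        Finset.prod_congr rfl fun i hi => by rw [hup i hi]
      simp_rw [Finset.prod_insert hjS, Function.update_self, e1, e2] at key
      rw [Measure.map_apply hpair (hs.prod ht), withDensity_apply _ (hpair (hs.prod ht)),
        Measure.compProd_apply_prod hs ht, setLIntegral_map hs (κ.measurable_coe ht) (hdm j),
        setLIntegral_withDensity_eq_setLIntegral_mul _ hH₂m hκt (hdm j hs),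
        ← lintegral_indicator (hpair (hs.prod ht)), ← lintegral_indicator (hdm j hs)]
      convert! key using 1
      · refine lintegral_congr fun ω => ?_
        by_cases h1 : d j ω ∈ s <;> by_cases h2 : Y j ω ∈ t <;> simp [h1, h2, hH₁, indicator]
      · refine lintegral_congr fun ω => ?_
        by_cases h1 : d j ω ∈ s
        · simp [h1, hH₂, indicator]; ring
        · simp [h1, indicator]
    have h1 : ∫⁻ ω, H₁ ω * φ (d j ω, Y j ω) ∂P =
        ∫⁻ ω, H₂ ω * ∫⁻ y, φ (d j ω, y) ∂(κ (d j ω)) ∂P := by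
      calc _ = ∫⁻ ω, φ (d j ω, Y j ω) ∂(P.withDensity H₁) :=
            (lintegral_withDensity_eq_lintegral_mul _ hH₁m (hφ.comp hpair)).symm
        _ = ∫⁻ x, φ x ∂((P.withDensity H₂).map (d j) ⊗ₘ κ) := by
            rw [← hmeas, lintegral_map hφ hpair]
        _ = ∫⁻ ω, ∫⁻ y, φ (d j ω, y) ∂(κ (d j ω)) ∂(P.withDensity H₂) := by
            have : IsFiniteMeasure (P.withDensity H₂) := by
              refine isFiniteMeasure_withDensity ((lintegral_mono (g := 1) fun ω => ?_).trans_lt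
                (by simp)).ne
              exact mul_le_one' (mul_le_one' (hG1 ω) (Finset.prod_le_one' fun i _ => prob_le_one))
                (Finset.prod_le_one' fun i _ => hg1 _)
            rw [Measure.lintegral_compProd hφ, lintegral_map hg (hdm j)]
        _ = _ := lintegral_withDensity_eq_lintegral_mul _ hH₂m (hg.comp (hdm j))
    simp_rw [Finset.prod_insert hj]
    convert! h1 using 3 <;> simp only [hH₁, hH₂] <;> ring

lemma lintegral_prod (h : IsCondIndepWithLaw P m Y fun i ω => κ (d i ω))
    (hm : m ≤ mΩ) (hY : ∀ i, Measurable (Y i)) (hd : ∀ i, Measurable[m] (d i))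
    {φ : D × M → ℝ≥0∞} (hφ : Measurable φ) (hφ1 : ∀ x, φ x ≤ 1) (T : Finset ι) :
    ∫⁻ ω, ∏ i ∈ T, φ (d i ω, Y i ω) ∂P =
      ∫⁻ ω, ∏ i ∈ T, ∫⁻ y, φ (d i ω, y) ∂(κ (d i ω)) ∂P := by
  simpa using h.lintegral_mul_prod_mul_prod hm hY hd hφ hφ1 T ∅ (by simp) (fun _ => univ)
    (fun _ => .univ) (fun _ => 1) (@measurable_const _ _ _ m 1) fun _ => le_rfl

end IsCondIndepWithLaw

/-! ### Laplace transform of the power received over one link -/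

/-- The Laplace transform of a gamma distribution. -/
lemma lintegral_eexpNeg_gammaMeasure {a b t : ℝ} (ha : 0 < a) (hb : 0 < b) (ht : 0 ≤ t) :
    ∫⁻ h, eexpNeg (ENNReal.ofReal (t * h)) ∂(gammaMeasure a b) =
      ENNReal.ofReal ((b / (b + t)) ^ a) := by
  have hE : Measurable fun h : ℝ => eexpNeg (ENNReal.ofReal (t * h)) :=
    measurable_eexpNeg.comp (by fun_prop)
  have hpdf : ∀ b, Measurable (gammaPDF a b) := fun b =>
    (measurable_gammaPDFReal a b).ennreal_ofReal
  -- Exponential tilting: e^{-th} times the density with rate b is (b/(b+t))^a times the density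
  -- with rate b+t, whose integral is 1. For h < 0 both densities vanish.
  rw [gammaMeasure, lintegral_withDensity_eq_lintegral_mul _ (hpdf b) hE,
    ← mul_one (ENNReal.ofReal _), ← lintegral_gammaPDF_eq_one ha (add_pos_of_pos_of_nonneg hb ht),
    ← lintegral_const_mul _ (hpdf _)]
  refine lintegral_congr fun h => ?_
  rw [Pi.mul_apply]
  rcases lt_or_ge h 0 with hh | hh
  · simp [gammaPDF_of_neg hh]
  · rw [gammaPDF_of_nonneg hh, gammaPDF_of_nonneg hh, eexpNeg_ofReal (mul_nonneg ht hh),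
      ← ENNReal.ofReal_mul' (Real.exp_pos _).le, ← ENNReal.ofReal_mul (by positivity)]
    congr 1
    have h1 : Real.exp (-((b + t) * h)) = Real.exp (-(b * h)) * Real.exp (-(t * h)) := by
      rw [← Real.exp_add]; congr 1; ring
    have h2 : (b + t) ^ a ≠ 0 := (Real.rpow_pos_of_pos (by positivity) _).ne'
    rw [h1, Real.div_rpow hb.le (by positivity)]
    field_simp

lemma sum_lobe {A : Type*} [AddCommMonoid A] (f : Lobe → A) :
    ∑ i, f i = f Lobe.main + f Lobe.side :=
  Finset.sum_pair (by decide)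

lemma sum_status {A : Type*} [AddCommMonoid A] (f : Status → A) :
    ∑ i, f i = f Status.LoS + f Status.NLoS :=
  Finset.sum_pair (by decide)

namespace Params

variable (p : Params)

lemma nak_pos' (k : Status) : 0 < p.nak k := by
  cases k
  · exact p.nak_pos.trans p.nak_lt
  · exact p.nak_pos

lemma lobeProb_nonneg {θ : ℝ} (hθ : θ ∈ Icc 0 (2 * Real.pi)) (i : Lobe) : 0 ≤ lobeProb θ i := by
  have := Real.pi_pos
  cases i
  · exact div_nonneg hθ.1 (by positivity)
  · exact div_nonneg (by linarith [hθ.2]) (by positivity)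

lemma sum_lobeProb (θ : ℝ) : ∑ i, lobeProb θ i = 1 := by
  rw [sum_lobe, lobeProb, lobeProb]
  field_simp
  ring

lemma gainProb_nonneg (t₁ : TxKind) (t₂ : RxKind) (i j : Lobe) : 0 ≤ p.gainProb t₁ t₂ i j :=
  mul_nonneg (lobeProb_nonneg (p.txWidth_mem t₁) i) (lobeProb_nonneg (p.rxWidth_mem t₂) j)

lemma sum_gainProb (t₁ : TxKind) (t₂ : RxKind) : ∑ i, ∑ j, p.gainProb t₁ t₂ i j = 1 := by
  simp_rw [gainProb, ← Finset.mul_sum, sum_lobeProb, mul_one, sum_lobeProb]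

lemma statusProb_nonneg {r : ℝ} (hr : 0 ≤ r) (k : Status) : 0 ≤ p.statusProb r k := by
  cases k
  · exact (Real.exp_pos _).le
  · exact sub_nonneg.2 (Real.exp_le_one_iff.2 (by nlinarith [p.beta_pos]))

lemma sum_statusProb (r : ℝ) : ∑ k, p.statusProb r k = 1 := by
  rw [sum_status, statusProb, statusProb]; ring

lemma statusProb_le_one {r : ℝ} (hr : 0 ≤ r) (k : Status) : p.statusProb r k ≤ 1 :=
  p.sum_statusProb r ▸ Finset.single_le_sum (fun k _ => p.statusProb_nonneg hr k)
    (Finset.mem_univ k)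

lemma sum_statusProb_mul_gainProb (t₁ : TxKind) (t₂ : RxKind) (r : ℝ) :
    ∑ k, ∑ i, ∑ j, p.statusProb r k * p.gainProb t₁ t₂ i j = 1 := by
  simp_rw [← Finset.mul_sum, sum_gainProb, mul_one, sum_statusProb]

lemma measurable_statusProb (k : Status) : Measurable fun r => p.statusProb r k := by
  cases k <;> simp only [statusProb] <;> fun_prop

instance (k : Status) : IsProbabilityMeasure (gammaMeasure (p.nak k) (p.nak k)) :=
  isProbabilityMeasure_gammaMeasure (by exact_mod_cast p.nak_pos' k)
    (by exact_mod_cast p.nak_pos' k)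

lemma lintegral_linkLaw (t₁ : TxKind) (t₂ : RxKind) (r : ℝ) {f : Link → ℝ≥0∞}
    (hf : Measurable f) :
    ∫⁻ l, f l ∂(p.linkLaw t₁ t₂ r) =
      ∑ k, ∑ i, ∑ j, ENNReal.ofReal (p.statusProb r k * p.gainProb t₁ t₂ i j) *
        ∫⁻ h, f ((k, i, j), h) ∂(gammaMeasure (p.nak k) (p.nak k)) := by
  simp_rw [linkLaw, lintegral_finsetSum_measure, lintegral_smul_measure, smul_eq_mul]
  congr! with k _ i _ j _
  rw [Measure.dirac_prod, lintegral_map hf measurable_prodMk_left]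

lemma linkLaw_apply (t₁ : TxKind) (t₂ : RxKind) (r : ℝ) {A : Set Link} (hA : MeasurableSet A) :
    p.linkLaw t₁ t₂ r A =
      ∑ k, ∑ i, ∑ j, ENNReal.ofReal (p.statusProb r k * p.gainProb t₁ t₂ i j) *
        ∫⁻ h, A.indicator 1 ((k, i, j), h) ∂(gammaMeasure (p.nak k) (p.nak k)) := by
  rw [← lintegral_indicator_one hA, p.lintegral_linkLaw _ _ _ (measurable_one.indicator hA)]

lemma isProbabilityMeasure_linkLaw (t₁ : TxKind) (t₂ : RxKind) {r : ℝ} (hr : 0 ≤ r) :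
    IsProbabilityMeasure (p.linkLaw t₁ t₂ r) := by
  refine ⟨?_⟩
  rw [p.linkLaw_apply _ _ _ .univ]
  have h0 : ∀ k i j, 0 ≤ p.statusProb r k * p.gainProb t₁ t₂ i j := fun k i j =>
    mul_nonneg (p.statusProb_nonneg hr k) (p.gainProb_nonneg t₁ t₂ i j)
  have h1 := congrArg ENNReal.ofReal (p.sum_statusProb_mul_gainProb t₁ t₂ r)
  rw [ENNReal.ofReal_sum_of_nonneg fun k _ => Finset.sum_nonneg fun i _ =>
    Finset.sum_nonneg fun j _ => h0 k i j, ENNReal.ofReal_one] at h1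
  simp_rw [ENNReal.ofReal_sum_of_nonneg fun i _ => Finset.sum_nonneg fun j _ => h0 _ i j,
    ENNReal.ofReal_sum_of_nonneg fun j _ => h0 _ _ j] at h1
  simpa using h1

/-- The link law as a Markov kernel, extended evenly to negative lengths. -/
noncomputable def linkKernel (t₁ : TxKind) (t₂ : RxKind) : Kernel ℝ Link where
  toFun r := p.linkLaw t₁ t₂ |r|
  measurable' := by
    refine Measure.measurable_of_measurable_coe _ fun A hA => ?_
    simp_rw [p.linkLaw_apply t₁ t₂ _ hA]
    refine Finset.measurable_fun_sum _ fun k _ => Finset.measurable_fun_sum _ fun i _ =>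
      Finset.measurable_fun_sum _ fun j _ => ?_
    exact ((((p.measurable_statusProb k).comp (measurable_norm (α := ℝ))).mul_const
      _).ennreal_ofReal).mul_const _

lemma linkKernel_apply (t₁ : TxKind) (t₂ : RxKind) {r : ℝ} (hr : 0 ≤ r) :
    p.linkKernel t₁ t₂ r = p.linkLaw t₁ t₂ r := by
  change p.linkLaw t₁ t₂ |r| = _
  rw [abs_of_nonneg hr]

instance (t₁ : TxKind) (t₂ : RxKind) : IsMarkovKernel (p.linkKernel t₁ t₂) :=
  ⟨fun r => p.isProbabilityMeasure_linkLaw t₁ t₂ (abs_nonneg r)⟩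

/-- The discrete part of the state takes countably many values, so it may be fixed; then the
exponent and gains are constants. -/
lemma measurable_receivedPower (t₁ : TxKind) (t₂ : RxKind) :
    Measurable fun x : ℝ × Link => p.receivedPower t₁ t₂ x.1 x.2 := by
  have h : Measurable fun y : (Status × Lobe × Lobe) × (ℝ × ℝ) =>
      p.receivedPower t₁ t₂ y.2.1 (y.1, y.2.2) := by
    refine measurable_from_prod_countable_right fun a => ?_
    simp only [receivedPower, antennaGain]
    fun_prop
  have hg : Measurable fun x : ℝ × Link => (x.2.1, x.1, x.2.2) := by fun_prop
  exact h.comp hg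

lemma OmegaKIJ_eq (t₁ : TxKind) (t₂ : RxKind) (k : Status) (i j : Lobe) (s r : ℝ) :
    p.OmegaKIJ t₁ t₂ k i j s r = p.gainProb t₁ t₂ i j * p.statusProb r k *
      (1 - ((1 + s * p.power t₁ * p.txGain t₁ i * p.rxGain t₂ j /
        (p.nak k * r ^ p.alpha k)) ^ p.nak k)⁻¹) := by
  rw [OmegaKIJ, zpow_neg, zpow_natCast]

/-- The contribution of status `k` and lobes `i`, `j` to the Laplace transform of the power
received over a link. -/
lemma lintegral_eexpNeg_receivedPower_gammaMeasure (t₁ : TxKind) (t₂ : RxKind) {s r : ℝ}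
    (hs : 0 ≤ s) (hr : 0 < r) (k : Status) (i j : Lobe) :
    ∫⁻ h, eexpNeg (ENNReal.ofReal s * ENNReal.ofReal (p.receivedPower t₁ t₂ r ((k, i, j), h)))
        ∂(gammaMeasure (p.nak k) (p.nak k)) =
      ENNReal.ofReal ((1 + s * p.power t₁ * p.txGain t₁ i * p.rxGain t₂ j /
        (p.nak k * r ^ p.alpha k)) ^ p.nak k)⁻¹ := by
  have hN : (0 : ℝ) < p.nak k := by exact_mod_cast p.nak_pos' k
  have hrα := Real.rpow_pos_of_pos hr (p.alpha k)
  have hc : 0 ≤ s * p.power t₁ * p.txGain t₁ i * p.rxGain t₂ j :=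
    mul_nonneg (mul_nonneg (mul_nonneg hs (p.power_pos _).le) (p.txGain_pos _ _).le)
      (p.rxGain_pos _ _).le
  have ht : 0 ≤ s * p.power t₁ * p.txGain t₁ i * p.rxGain t₂ j / r ^ p.alpha k := by positivity
  have h1 : ∀ h, ENNReal.ofReal s * ENNReal.ofReal (p.receivedPower t₁ t₂ r ((k, i, j), h)) =
      ENNReal.ofReal (s * p.power t₁ * p.txGain t₁ i * p.rxGain t₂ j / r ^ p.alpha k * h) := by
    intro h
    rw [← ENNReal.ofReal_mul hs, receivedPower, antennaGain, Real.rpow_neg hr.le]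
    congr 1
    ring
  simp_rw [h1]
  rw [lintegral_eexpNeg_gammaMeasure hN hN ht, Real.rpow_natCast, ← inv_pow]
  congr 2
  field_simp

/-- The status and gain probabilities sum to 1, which cancels the constant terms of Ω. -/
lemma one_sub_Omega (t₁ : TxKind) (t₂ : RxKind) (s r : ℝ) :
    1 - p.Omega t₁ t₂ s r = ∑ k, ∑ i, ∑ j, p.statusProb r k * p.gainProb t₁ t₂ i j *
      ((1 + s * p.power t₁ * p.txGain t₁ i * p.rxGain t₂ j /
        (p.nak k * r ^ p.alpha k)) ^ p.nak k)⁻¹ := by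
  conv_lhs => rw [← p.sum_statusProb_mul_gainProb t₁ t₂ r]
  simp_rw [Omega, OmegaK, OmegaKIJ_eq, ← Finset.sum_sub_distrib]
  refine Finset.sum_congr rfl fun k _ => Finset.sum_congr rfl fun i _ =>
    Finset.sum_congr rfl fun j _ => ?_
  ring

/-- The Laplace transform of the power received over a link of length `r`. -/
lemma lintegral_eexpNeg_receivedPower (t₁ : TxKind) (t₂ : RxKind) {s r : ℝ}
    (hs : 0 ≤ s) (hr : 0 < r) :
    ∫⁻ l, eexpNeg (ENNReal.ofReal s * ENNReal.ofReal (p.receivedPower t₁ t₂ r l))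
      ∂(p.linkLaw t₁ t₂ r) = ENNReal.ofReal (1 - p.Omega t₁ t₂ s r) := by
  have hm : Measurable fun l => p.receivedPower t₁ t₂ r l :=
    (p.measurable_receivedPower t₁ t₂).comp measurable_prodMk_left
  have hE : Measurable fun l =>
      eexpNeg (ENNReal.ofReal s * ENNReal.ofReal (p.receivedPower t₁ t₂ r l)) :=
    measurable_eexpNeg.comp (hm.ennreal_ofReal.const_mul _)
  rw [p.lintegral_linkLaw t₁ t₂ r hE, one_sub_Omega]
  have h0 : ∀ k i j, 0 ≤ p.statusProb r k * p.gainProb t₁ t₂ i j := fun k i j =>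
    mul_nonneg (p.statusProb_nonneg hr.le k) (p.gainProb_nonneg t₁ t₂ i j)
  have h1 : ∀ k i j, 0 ≤ p.statusProb r k * p.gainProb t₁ t₂ i j *
      ((1 + s * p.power t₁ * p.txGain t₁ i * p.rxGain t₂ j /
        (p.nak k * r ^ p.alpha k)) ^ p.nak k)⁻¹ := fun k i j => by
    have := h0 k i j
    have := p.power_pos t₁
    have := p.txGain_pos t₁ i
    have := p.rxGain_pos t₂ j
    positivity
  rw [ENNReal.ofReal_sum_of_nonneg fun k _ => Finset.sum_nonneg fun i _ =>
    Finset.sum_nonneg fun j _ => h1 k i j]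
  simp_rw [ENNReal.ofReal_sum_of_nonneg fun i _ => Finset.sum_nonneg fun j _ => h1 _ i j,
    ENNReal.ofReal_sum_of_nonneg fun j _ => h1 _ _ j]
  congr! with k _ i _ j _
  rw [p.lintegral_eexpNeg_receivedPower_gammaMeasure t₁ t₂ hs hr, ENNReal.ofReal_mul (h0 k i j)]

/-! ### Bounds, integrability and small-s behaviour of Ω -/

lemma OmegaKIJ_nonneg (t₁ : TxKind) (t₂ : RxKind) {s r : ℝ} (hs : 0 ≤ s) (hr : 0 ≤ r)
    (k : Status) (i j : Lobe) : 0 ≤ p.OmegaKIJ t₁ t₂ k i j s r := by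
  have := p.power_pos t₁
  have := p.txGain_pos t₁ i
  have := p.rxGain_pos t₂ j
  rw [OmegaKIJ_eq]
  refine mul_nonneg (mul_nonneg (p.gainProb_nonneg _ _ _ _) (p.statusProb_nonneg hr k))
    (sub_nonneg.2 (inv_le_one_of_one_le₀ (one_le_pow₀ (le_add_of_nonneg_right ?_))))
  positivity

lemma Omega_nonneg (t₁ : TxKind) (t₂ : RxKind) {s r : ℝ} (hs : 0 ≤ s) (hr : 0 ≤ r) :
    0 ≤ p.Omega t₁ t₂ s r :=
  Finset.sum_nonneg fun k _ => Finset.sum_nonneg fun i _ => Finset.sum_nonneg fun j _ =>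
    p.OmegaKIJ_nonneg t₁ t₂ hs hr k i j

lemma Omega_le_one (t₁ : TxKind) (t₂ : RxKind) {s r : ℝ} (hs : 0 ≤ s) (hr : 0 ≤ r) :
    p.Omega t₁ t₂ s r ≤ 1 := by
  rw [← sub_nonneg, one_sub_Omega]
  refine Finset.sum_nonneg fun k _ => Finset.sum_nonneg fun i _ => Finset.sum_nonneg fun j _ => ?_
  have := p.power_pos t₁
  have := p.txGain_pos t₁ i
  have := p.rxGain_pos t₂ j
  have := p.gainProb_nonneg t₁ t₂ i j
  have := p.statusProb_nonneg hr k
  positivity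

lemma measurable_OmegaKIJ (t₁ : TxKind) (t₂ : RxKind) (s : ℝ) (k : Status) (i j : Lobe) :
    Measurable fun r => p.OmegaKIJ t₁ t₂ k i j s r := by
  simp_rw [OmegaKIJ_eq]
  have := p.measurable_statusProb k
  fun_prop

lemma measurable_Omega (t₁ : TxKind) (t₂ : RxKind) (s : ℝ) :
    Measurable fun r => p.Omega t₁ t₂ s r :=
  Finset.measurable_fun_sum _ fun k _ => Finset.measurable_fun_sum _ fun i _ =>
    Finset.measurable_fun_sum _ fun j _ => p.measurable_OmegaKIJ t₁ t₂ s k i j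

/-- Combines (1+x)^n ≤ e^{nx} with 1 - e^{-y} ≤ y. -/
lemma one_sub_inv_one_add_pow_le {x : ℝ} (hx : 0 ≤ x) (n : ℕ) :
    1 - ((1 + x) ^ n)⁻¹ ≤ n * x := by
  have h1 : (1 + x) ^ n ≤ Real.exp (n * x) := by
    rw [Real.exp_nat_mul]
    exact pow_le_pow_left₀ (by positivity) (by linarith [Real.add_one_le_exp x]) n
  have h2 : Real.exp (-(n * x)) ≤ ((1 + x) ^ n)⁻¹ := by
    rw [Real.exp_neg]
    exact inv_anti₀ (by positivity) h1
  linarith [Real.add_one_le_exp (-(n * x))]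

/-- On (0,1] the integrand is bounded by the gain probability. On (1,∞) the line-of-sight term is at
most a multiple of r e^{-βr}, the blocked term at most a multiple of r^{1-α_N}; the latter tail is
where 2 < α_N enters. -/
lemma integrableOn_OmegaKIJ_mul (hα : 2 < p.alpha Status.NLoS) (t₁ : TxKind) (t₂ : RxKind)
    {s : ℝ} (hs : 0 ≤ s) (k : Status) (i j : Lobe) :
    IntegrableOn (fun r => p.OmegaKIJ t₁ t₂ k i j s r * r) (Ioi 0) := by
  have hP := p.power_pos t₁
  have hT := p.txGain_pos t₁ i
  have hR := p.rxGain_pos t₂ j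
  have hN : (0 : ℝ) < p.nak k := by exact_mod_cast p.nak_pos' k
  have hg := p.gainProb_nonneg t₁ t₂ i j
  set c := s * p.power t₁ * p.txGain t₁ i * p.rxGain t₂ j with hc
  have hc0 : 0 ≤ c := by positivity
  have hm : Measurable fun r => p.OmegaKIJ t₁ t₂ k i j s r * r :=
    (p.measurable_OmegaKIJ t₁ t₂ s k i j).mul measurable_id
  -- In the third bound the Nakagami parameter cancels: N_k · c / (N_k r^α) = c r^{-α}.
  have hbound : ∀ r, 0 < r → 0 ≤ 1 - ((1 + c / (p.nak k * r ^ p.alpha k)) ^ p.nak k)⁻¹ ∧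
      1 - ((1 + c / (p.nak k * r ^ p.alpha k)) ^ p.nak k)⁻¹ ≤ 1 ∧
      1 - ((1 + c / (p.nak k * r ^ p.alpha k)) ^ p.nak k)⁻¹ ≤ c * r ^ (-p.alpha k) := by
    intro r hr
    have hrα := Real.rpow_pos_of_pos hr (p.alpha k)
    refine ⟨sub_nonneg.2 (inv_le_one_of_one_le₀ (one_le_pow₀ (le_add_of_nonneg_right
      (by positivity)))), sub_le_self _ (by positivity), ?_⟩
    refine (one_sub_inv_one_add_pow_le (by positivity) _).trans_eq ?_
    rw [Real.rpow_neg hr.le]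
    field_simp
  have hnn : ∀ r ∈ Ioi (0 : ℝ), 0 ≤ p.OmegaKIJ t₁ t₂ k i j s r * r := fun r (hr : 0 < r) =>
    mul_nonneg (p.OmegaKIJ_nonneg t₁ t₂ hs hr.le k i j) hr.le
  rw [← Ioc_union_Ioi_eq_Ioi zero_le_one]
  refine IntegrableOn.union ?_ ?_
  · refine Integrable.mono' (g := fun _ => p.gainProb t₁ t₂ i j) (by simp)
      hm.aestronglyMeasurable
      ((ae_restrict_mem measurableSet_Ioc).mono fun r hr => ?_)
    rw [Real.norm_of_nonneg (hnn r hr.1), OmegaKIJ_eq, mul_assoc, mul_assoc]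
    refine mul_le_of_le_one_right hg (mul_le_one₀ (p.statusProb_le_one hr.1.le k)
      (mul_nonneg (hbound r hr.1).1 hr.1.le)
      (mul_le_one₀ (hbound r hr.1).2.1 hr.1.le hr.2))
  · cases k with
    | LoS =>
      have hi : IntegrableOn (fun r => p.gainProb t₁ t₂ i j * (r ^ (1 : ℝ) *
          Real.exp (-p.beta * r ^ (1 : ℝ)))) (Ioi 1) :=
        ((integrableOn_rpow_mul_exp_neg_mul_rpow (by norm_num) zero_lt_one p.beta_pos).mono_set
          (Ioi_subset_Ioi zero_le_one)).const_mul _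
      refine Integrable.mono' hi hm.aestronglyMeasurable
        ((ae_restrict_mem measurableSet_Ioi).mono fun r hr => ?_)
      have hr0 : 0 < r := zero_lt_one.trans hr
      rw [Real.norm_of_nonneg (hnn r hr0), OmegaKIJ_eq, Real.rpow_one, mul_comm r, mul_assoc,
        mul_assoc]
      refine mul_le_mul_of_nonneg_left (mul_le_mul_of_nonneg_left ?_ (Real.exp_pos _).le) hg
      exact mul_le_of_le_one_left hr0.le (hbound r hr0).2.1
    | NLoS =>
      have hi : IntegrableOn (fun r : ℝ => p.gainProb t₁ t₂ i j * (c *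
          r ^ (1 - p.alpha Status.NLoS))) (Ioi 1) :=
        ((integrableOn_Ioi_rpow_of_lt (by linarith) zero_lt_one).const_mul _).const_mul _
      refine Integrable.mono' hi hm.aestronglyMeasurable
        ((ae_restrict_mem measurableSet_Ioi).mono fun r hr => ?_)
      have hr0 : 0 < r := zero_lt_one.trans hr
      rw [Real.norm_of_nonneg (hnn r hr0), OmegaKIJ_eq, mul_assoc, mul_assoc,
        show 1 - p.alpha Status.NLoS = -p.alpha Status.NLoS + 1 by ring, Real.rpow_add hr0,
        Real.rpow_one, ← mul_assoc c]
      refine mul_le_mul_of_nonneg_left ?_ hg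
      refine (mul_le_of_le_one_left (mul_nonneg (hbound r hr0).1 hr0.le)
        (p.statusProb_le_one hr0.le _)).trans ?_
      exact mul_le_mul_of_nonneg_right (hbound r hr0).2.2 hr0.le

lemma integrableOn_Omega_mul (hα : 2 < p.alpha Status.NLoS) (t₁ : TxKind) (t₂ : RxKind)
    {s : ℝ} (hs : 0 ≤ s) : IntegrableOn (fun r => p.Omega t₁ t₂ s r * r) (Ioi 0) := by
  simp_rw [Omega, OmegaK, Finset.sum_mul]
  exact integrable_finsetSum _ fun k _ => integrable_finsetSum _ fun i _ =>
    integrable_finsetSum _ fun j _ => p.integrableOn_OmegaKIJ_mul hα t₁ t₂ hs k i j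

lemma OmegaKIJ_mono (t₁ : TxKind) (t₂ : RxKind) {s s' r : ℝ} (hs : 0 ≤ s) (hss' : s ≤ s')
    (hr : 0 ≤ r) (k : Status) (i j : Lobe) :
    p.OmegaKIJ t₁ t₂ k i j s r ≤ p.OmegaKIJ t₁ t₂ k i j s' r := by
  have := p.power_pos t₁
  have := p.txGain_pos t₁ i
  have := p.rxGain_pos t₂ j
  have := mul_nonneg (p.gainProb_nonneg t₁ t₂ i j) (p.statusProb_nonneg hr k)
  simp_rw [OmegaKIJ_eq]
  gcongr

lemma Omega_mono (t₁ : TxKind) (t₂ : RxKind) {s s' r : ℝ} (hs : 0 ≤ s) (hss' : s ≤ s')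
    (hr : 0 ≤ r) : p.Omega t₁ t₂ s r ≤ p.Omega t₁ t₂ s' r :=
  Finset.sum_le_sum fun k _ => Finset.sum_le_sum fun i _ => Finset.sum_le_sum fun j _ =>
    p.OmegaKIJ_mono t₁ t₂ hs hss' hr k i j

lemma Omega_zero (t₁ : TxKind) (t₂ : RxKind) (r : ℝ) : p.Omega t₁ t₂ 0 r = 0 := by
  simp [Omega, OmegaK, OmegaKIJ]

lemma continuousAt_Omega_zero (t₁ : TxKind) (t₂ : RxKind) (r : ℝ) :
    ContinuousAt (fun s => p.Omega t₁ t₂ s r) 0 := by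
  simp_rw [Omega, OmegaK, OmegaKIJ_eq]
  refine tendsto_finsetSum _ fun k _ => tendsto_finsetSum _ fun i _ =>
    tendsto_finsetSum _ fun j _ => ?_
  refine ContinuousAt.mul continuousAt_const (ContinuousAt.sub continuousAt_const
    (ContinuousAt.inv₀ (by fun_prop) (by simp)))

end Params

/-! ### Radial integrals in the plane -/

/-- Polar coordinates for radial functions. -/
lemma lintegral_fun_norm_addHaar {E : Type*} [NormedAddCommGroup E] [NormedSpace ℝ E]
    [MeasurableSpace E] [BorelSpace E] [FiniteDimensional ℝ E] [Nontrivial E] (μ : Measure E)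
    [μ.IsAddHaarMeasure] {f : ℝ → ℝ≥0∞} (hf : Measurable f) :
    ∫⁻ x, f ‖x‖ ∂μ = Module.finrank ℝ E * μ (Metric.ball 0 1) *
      ∫⁻ r in Ioi (0 : ℝ), ENNReal.ofReal (r ^ (Module.finrank ℝ E - 1)) * f r := by
  have h0 : MeasurableSet ({(0 : E)}ᶜ) := (measurableSet_singleton _).compl
  have hmp := μ.measurePreserving_homeomorphUnitSphereProd
  have hfs : Measurable fun r : Ioi (0 : ℝ) => f r := hf.comp measurable_subtype_coe
  have hfs' : Measurable fun y : Metric.sphere (0 : E) 1 × Ioi (0 : ℝ) => f y.2 :=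
    hfs.comp measurable_snd
  calc ∫⁻ x, f ‖x‖ ∂μ = ∫⁻ x in {(0 : E)}ᶜ, f ‖x‖ ∂μ := by rw [restrict_compl_singleton]
    _ = ∫⁻ x : ({(0 : E)}ᶜ : Set E), f ‖x.1‖ ∂(μ.comap (↑)) :=
        (lintegral_subtype_comap h0 fun x => f ‖x‖).symm
    _ = ∫⁻ y, f y.2 ∂(μ.toSphere.prod (Measure.volumeIoiPow (Module.finrank ℝ E - 1))) := by
        rw [← hmp.lintegral_comp hfs']
        simp
    _ = μ.toSphere univ * ∫⁻ r, f r ∂(Measure.volumeIoiPow (Module.finrank ℝ E - 1)) := by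
        rw [lintegral_prod _ hfs'.aemeasurable]
        simp [mul_comm]
    _ = _ := by
        rw [Measure.toSphere_apply_univ, Measure.volumeIoiPow,
          lintegral_withDensity_eq_lintegral_mul _ (by fun_prop) hfs]
        congr 1
        exact lintegral_subtype_comap (μ := volume) measurableSet_Ioi
          fun r => ENNReal.ofReal (r ^ (Module.finrank ℝ E - 1)) * f r

lemma lintegral_plane_radial (y : Plane) {f : ℝ → ℝ≥0∞} (hf : Measurable f) :
    ∫⁻ x : Plane, f (dist x y) =
      ENNReal.ofReal (2 * Real.pi) * ∫⁻ r in Ioi (0 : ℝ), f r * ENNReal.ofReal r := by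
  simp_rw [dist_eq_norm]
  rw [lintegral_sub_right_eq_self (fun x : Plane => f ‖x‖) y, lintegral_fun_norm_addHaar volume hf,
    EuclideanSpace.volume_ball_fin_two, finrank_euclideanSpace_fin]
  simp only [Nat.cast_ofNat, Nat.add_one_sub_one, pow_one, mul_comm (f _)]
  congr 1
  rw [ENNReal.ofReal_mul zero_le_two]
  simp

/-! ### The interference: Laplace transform and almost sure finiteness -/

namespace Params

variable (p : Params)

/-- The Laplace transform of the power received over a link of length `r`. -/
noncomputable def linkLaplace (s r : ℝ) : ℝ≥0∞ :=
  ∫⁻ l, eexpNeg (ENNReal.ofReal s * ENNReal.ofReal (p.receivedPower TxKind.T RxKind.R r l))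
    ∂(p.linkKernel TxKind.T RxKind.R r)

lemma measurable_linkFactor (s : ℝ) : Measurable fun x : ℝ × Link =>
    eexpNeg (ENNReal.ofReal s *
      ENNReal.ofReal (p.receivedPower TxKind.T RxKind.R x.1 x.2)) :=
  measurable_eexpNeg.comp ((p.measurable_receivedPower _ _).ennreal_ofReal.const_mul _)

lemma measurable_linkLaplace (s : ℝ) : Measurable (p.linkLaplace s) :=
  (p.measurable_linkFactor s).lintegral_kernel_prod_right'

lemma linkLaplace_le_one (s r : ℝ) : p.linkLaplace s r ≤ 1 :=
  (lintegral_mono fun _ => eexpNeg_le_one _).trans (by simp)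

/-- Identifies the integrand 1 - e^{-u} of the Laplace functional with Ω. The bound Ω ≤ 1 keeps the
subtraction in [0,∞] from truncating. -/
lemma one_sub_linkLaplace {s r : ℝ} (hs : 0 ≤ s) (hr : 0 < r) :
    1 - p.linkLaplace s r = ENNReal.ofReal (p.Omega TxKind.T RxKind.R s r) := by
  rw [linkLaplace, p.linkKernel_apply _ _ hr.le, p.lintegral_eexpNeg_receivedPower _ _ hs hr,
    ← ENNReal.ofReal_one, ← ENNReal.ofReal_sub _ (sub_nonneg.2 (p.Omega_le_one _ _ hs hr.le)),
    sub_sub_cancel]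

end Params

namespace Network

variable {Ω : Type*} [mΩ : MeasurableSpace Ω] {P : Measure Ω} {p : Params} {net : Network Ω}

lemma IsModel.measurable_locations (hmodel : net.IsModel p P) : Measurable net.locations :=
  (((measurable_pi_lambda _ hmodel.poisson_tx.measurable).prodMk
    (measurable_pi_lambda _ hmodel.poisson_rx.measurable)).prodMk
    (measurable_pi_lambda _ hmodel.poisson_eve.measurable)).prodMk hmodel.measurable_angle

lemma measurable_tx_locSigma {Ω : Type*} (net : Network Ω) (n : ℕ) :
    Measurable[net.locSigma] (net.tx n) := by
  have h : Measurable[net.locSigma] net.locations := comap_measurable _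
  exact (measurable_pi_apply n).comp (measurable_fst.comp
    (measurable_fst.comp (measurable_fst.comp h)))

lemma IsModel.measurable_interference (hmodel : net.IsModel p P) (a : Attack) :
    Measurable (net.interference p a TxKind.T) :=
  Measurable.tsum fun n => ((p.measurable_receivedPower TxKind.T RxKind.R).comp
    (((hmodel.poisson_tx.measurable n).dist measurable_const).prodMk
      (hmodel.measurable_linkTY n))).ennreal_ofReal

/-- The Laplace transform of the interference from the transmitters, with values in `[0, ∞]`. -/
theorem IsModel.lintegral_eexpNeg_interference [IsProbabilityMeasure P]
    (hmodel : net.IsModel p P) (a : Attack) {s : ℝ} (hs : 0 ≤ s) :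
    ∫⁻ ω, eexpNeg (ENNReal.ofReal s * net.interference p a TxKind.T ω) ∂P =
      eexpNeg (ENNReal.ofReal (2 * Real.pi * p.lam) * ∫⁻ r in Ioi (0 : ℝ),
        ENNReal.ofReal (p.Omega TxKind.T RxKind.R s r * r)) := by
  have hm : net.locSigma ≤ mΩ := hmodel.measurable_locations.comap_le
  have hd : ∀ n, Measurable[net.locSigma] fun ω => dist (net.tx n ω) net.y₀ := fun n =>
    (measurable_id.dist measurable_const).comp (measurable_tx_locSigma net n)
  have hdm := fun n => (hd n).mono hm le_rfl
  -- Distances are nonnegative, so the even extension that makes the link law a Markov kernel on ℝ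
  -- changes nothing here.
  have hci : IsCondIndepWithLaw P net.locSigma net.linkTY
      fun n ω => p.linkKernel TxKind.T RxKind.R (dist (net.tx n ω) net.y₀) := by
    simp_rw [p.linkKernel_apply _ _ dist_nonneg]
    exact hmodel.linkTY_law
  set φ : ℝ × Link → ℝ≥0∞ := fun x => eexpNeg (ENNReal.ofReal s *
    ENNReal.ofReal (p.receivedPower TxKind.T RxKind.R x.1 x.2)) with hφ
  have hφm : Measurable φ := p.measurable_linkFactor s
  have hφ1 : ∀ x, φ x ≤ 1 := fun x => eexpNeg_le_one _
  have hstep := fun N => hci.lintegral_prod hm hmodel.measurable_linkTY hd hφm hφ1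
    (Finset.range N)
  -- Chosen so that e^{-u} is the averaged link factor, which brings the product over transmitters
  -- into the form of the Laplace functional.
  let u : Plane → ℝ≥0∞ := fun x => (-ENNReal.log (p.linkLaplace s (dist x net.y₀))).toENNReal
  have hu : Measurable u := by
    have := p.measurable_linkLaplace s
    exact (continuous_neg.measurable.comp (ENNReal.measurable_log.comp
      (this.comp (measurable_id.dist measurable_const)))).ereal_toENNReal
  have hue : ∀ x, eexpNeg (u x) = p.linkLaplace s (dist x net.y₀) := fun x =>
    eexpNeg_neg_log (p.linkLaplace_le_one s _)
  have hlim1 : Tendsto (fun N => ∫⁻ ω, ∏ n ∈ Finset.range N,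
      φ (dist (net.tx n ω) net.y₀, net.linkTY n ω) ∂P) atTop
      (𝓝 (∫⁻ ω, eexpNeg (ENNReal.ofReal s * net.interference p a TxKind.T ω) ∂P)) := by
    refine tendsto_lintegral_of_dominated_convergence 1
      (fun N => Finset.measurable_fun_prod _ fun n _ =>
        hφm.comp ((hdm n).prodMk (hmodel.measurable_linkTY n)))
      (fun N => .of_forall fun ω => Finset.prod_le_one' fun n _ => hφ1 _) (by simp)
      (.of_forall fun ω => ?_)
    rw [interference, ← ENNReal.tsum_mul_left]
    exact tendsto_eexpNeg_sum_range _
  have hlim2 : Tendsto (fun N => ∫⁻ ω, ∏ n ∈ Finset.range N,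
      p.linkLaplace s (dist (net.tx n ω) net.y₀) ∂P) atTop
      (𝓝 (∫⁻ ω, eexpNeg (∑' n, u (net.tx n ω)) ∂P)) := by
    refine tendsto_lintegral_of_dominated_convergence 1
      (fun N => Finset.measurable_fun_prod _ fun n _ => (p.measurable_linkLaplace s).comp (hdm n))
      (fun N => .of_forall fun ω => Finset.prod_le_one' fun n _ => p.linkLaplace_le_one s _)
      (by simp) (.of_forall fun ω => ?_)
    simp_rw [← hue]
    exact tendsto_eexpNeg_sum_range _
  have : SigmaFinite (ENNReal.ofReal p.lam • (volume : Measure Plane)) := by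
    rw [← withDensity_const]
    exact SigmaFinite.withDensity_of_ne_top
      (.of_forall fun _ => ENNReal.ofReal_ne_top)
  rw [tendsto_nhds_unique hlim1 (by simp_rw [hstep]; exact hlim2),
    hmodel.poisson_tx.lintegral_eexpNeg_tsum hu]
  congr 1
  simp_rw [hue]
  rw [lintegral_smul_measure, smul_eq_mul, lintegral_plane_radial net.y₀
    (f := fun r => 1 - p.linkLaplace s r) (measurable_const.sub (p.measurable_linkLaplace s)),
    ← mul_assoc, ← ENNReal.ofReal_mul p.lam_pos.le, mul_comm p.lam]
  congr 1
  -- Only r > 0 matters, so the conventional value of the power at distance 0 is irrelevant.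
  refine setLIntegral_congr_fun measurableSet_Ioi fun r (hr : 0 < r) => ?_
  rw [ENNReal.ofReal_mul' hr.le, ← p.one_sub_linkLaplace hs hr]

/-- For s > 0, e^{-sI} is at most the indicator of I < ∞, so P(I < ∞) ≥ E e^{-sI}; by the Laplace
formula the right side tends to 1 as s → 0. -/
lemma IsModel.ae_interference_lt_top [IsProbabilityMeasure P] (hmodel : net.IsModel p P)
    (a : Attack) (hα : 2 < p.alpha Status.NLoS) :
    ∀ᵐ ω ∂P, net.interference p a TxKind.T ω < ∞ := by
  have hX := hmodel.measurable_interference a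
  have hset : MeasurableSet {ω | net.interference p a TxKind.T ω < ∞} :=
    measurableSet_lt hX measurable_const
  let s : ℕ → ℝ := fun n => 1 / ((n : ℝ) + 1)
  have hs0 : ∀ n, 0 < s n := fun n => Nat.one_div_pos_of_nat
  have hs1 : ∀ n, s n ≤ 1 := fun n => by
    rw [div_le_one (by positivity)]; linarith [(n.cast_nonneg : (0 : ℝ) ≤ n)]
  have hle : ∀ n, ∫⁻ ω, eexpNeg (ENNReal.ofReal (s n) * net.interference p a TxKind.T ω) ∂P ≤
      P {ω | net.interference p a TxKind.T ω < ∞} := by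
    intro n
    rw [← lintegral_indicator_one hset]
    refine lintegral_mono fun ω => ?_
    by_cases h : net.interference p a TxKind.T ω < ∞
    · rw [indicator_of_mem (by exact h)]
      exact eexpNeg_le_one _
    · rw [not_lt_top_iff.1 h, ENNReal.mul_top (by simpa using hs0 n), eexpNeg_top]
      exact zero_le
  -- Since 0 < s_n ≤ 1 and Ω increases in s, the integrable function Ω(1,r) r dominates.
  have hlim : Tendsto (fun n => ∫⁻ r in Ioi (0 : ℝ),
      ENNReal.ofReal (p.Omega TxKind.T RxKind.R (s n) r * r)) atTop (𝓝 0) := by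
    rw [← lintegral_zero (μ := volume.restrict (Ioi (0 : ℝ)))]
    refine tendsto_lintegral_of_dominated_convergence
      (fun r => ENNReal.ofReal (p.Omega TxKind.T RxKind.R 1 r * r))
      (fun n => ((p.measurable_Omega _ _ _).mul measurable_id).ennreal_ofReal)
      (fun n => (ae_restrict_mem measurableSet_Ioi).mono fun r (hr : 0 < r) => ?_)
      (p.integrableOn_Omega_mul hα _ _ zero_le_one).lintegral_lt_top.ne
      (.of_forall fun r => ?_)
    · exact ENNReal.ofReal_le_ofReal (mul_le_mul_of_nonneg_right
        (p.Omega_mono _ _ (hs0 n).le (hs1 n) hr.le) hr.le)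
    · have h := ((p.continuousAt_Omega_zero TxKind.T RxKind.R r).tendsto.comp
        (tendsto_one_div_add_atTop_nhds_zero_nat (𝕜 := ℝ))).mul_const r
      rw [p.Omega_zero, zero_mul] at h
      exact ENNReal.ofReal_zero ▸ ENNReal.tendsto_ofReal h
  have hlim' : Tendsto (fun n =>
      ∫⁻ ω, eexpNeg (ENNReal.ofReal (s n) * net.interference p a TxKind.T ω) ∂P) atTop (𝓝 1) := by
    simp_rw [fun n => hmodel.lintegral_eexpNeg_interference a (hs0 n).le]
    have h := ENNReal.Tendsto.const_mul (a := ENNReal.ofReal (2 * Real.pi * p.lam)) hlim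
      (.inr ENNReal.ofReal_ne_top)
    rw [mul_zero] at h
    exact eexpNeg_zero ▸ (continuous_eexpNeg.tendsto _).comp h
  exact (prob_compl_eq_zero_iff hset).2
    (le_antisymm prob_le_one (le_of_tendsto' hlim' hle))

end Network

/-! ### Return to real-valued expressions -/

lemma laplaceTransform_eq_toReal {Ω : Type*} [MeasurableSpace Ω] (P : Measure Ω)
    {X : Ω → ℝ≥0∞} (hX : Measurable X) (s : ℝ) :
    laplaceTransform P X s = (∫⁻ ω, eexpNeg (ENNReal.ofReal s * X ω) ∂P).toReal := by
  have hm : Measurable fun ω => expNeg (ENNReal.ofReal s * X ω) := by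
    simp_rw [expNeg_eq_toReal]
    exact (measurable_eexpNeg.comp (hX.const_mul _)).ennreal_toReal
  rw [laplaceTransform, integral_eq_lintegral_of_nonneg_ae (.of_forall fun _ => expNeg_nonneg _)
    hm.aestronglyMeasurable]
  simp_rw [ofReal_expNeg]

end OWJ

theorem mainTheorem12 {Ω : Type*} [MeasurableSpace Ω] (P : Measure Ω) [IsProbabilityMeasure P]
    (p : OWJ.Params) (net : OWJ.Network Ω) (hmodel : net.IsModel p P)
    (a : OWJ.Attack) (s : ℝ) (hs : 0 ≤ s) :
    OWJ.laplaceTransform P (net.interference p a OWJ.TxKind.T) s =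
        OWJ.expNeg (ENNReal.ofReal (2 * Real.pi * p.lam) *
          ∫⁻ r in Ioi (0 : ℝ), ENNReal.ofReal (p.Omega OWJ.TxKind.T OWJ.RxKind.R s r * r)) ∧
      (2 < p.alpha OWJ.Status.NLoS →
        (∀ᵐ ω ∂P, net.interference p a OWJ.TxKind.T ω < ∞) ∧
        IntegrableOn (fun r => p.Omega OWJ.TxKind.T OWJ.RxKind.R s r * r) (Ioi 0) ∧
        ∫ ω, Real.exp (-s * (net.interference p a OWJ.TxKind.T ω).toReal) ∂P =
          Real.exp (-2 * Real.pi * p.lam *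
            ∫ r in Ioi (0 : ℝ), p.Omega OWJ.TxKind.T OWJ.RxKind.R s r * r)) := by
  have hmain : OWJ.laplaceTransform P (net.interference p a OWJ.TxKind.T) s =
      OWJ.expNeg (ENNReal.ofReal (2 * Real.pi * p.lam) *
        ∫⁻ r in Ioi (0 : ℝ), ENNReal.ofReal (p.Omega OWJ.TxKind.T OWJ.RxKind.R s r * r)) := by
    rw [OWJ.laplaceTransform_eq_toReal P (hmodel.measurable_interference a),
      hmodel.lintegral_eexpNeg_interference a hs, OWJ.expNeg_eq_toReal]
  refine ⟨hmain, fun hα => ?_⟩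
  have hfin := hmodel.ae_interference_lt_top a hα
  have hint := p.integrableOn_Omega_mul hα OWJ.TxKind.T OWJ.RxKind.R hs
  refine ⟨hfin, hint, ?_⟩
  have hnn : ∀ r ∈ Ioi (0 : ℝ), 0 ≤ p.Omega OWJ.TxKind.T OWJ.RxKind.R s r * r :=
    fun r (hr : 0 < r) => mul_nonneg (p.Omega_nonneg _ _ hs hr.le) hr.le
  have hlam : 0 ≤ 2 * Real.pi * p.lam := by
    have := p.lam_pos
    positivity
  rw [← ofReal_integral_eq_lintegral_ofReal hint
    ((ae_restrict_mem measurableSet_Ioi).mono hnn), ← ENNReal.ofReal_mul hlam, OWJ.expNeg,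
    if_neg ENNReal.ofReal_ne_top, ENNReal.toReal_ofReal
      (mul_nonneg hlam (setIntegral_nonneg measurableSet_Ioi hnn))] at hmain
  -- On I = ∞, `toReal` gives 0 and the left integrand would be 1, so the two integrands are
  -- compared only almost everywhere.
  have hL : ∫ ω, Real.exp (-s * (net.interference p a OWJ.TxKind.T ω).toReal) ∂P =
      OWJ.laplaceTransform P (net.interference p a OWJ.TxKind.T) s := by
    refine integral_congr_ae (hfin.mono fun ω hω => ?_)
    dsimp only
    rw [OWJ.expNeg, if_neg (ENNReal.mul_ne_top ENNReal.ofReal_ne_top hω.ne), ENNReal.toReal_mul,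
      ENNReal.toReal_ofReal hs, neg_mul]
  rw [hL, hmain]
  congr 1
  ring
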